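/- \textbf{Conventions.} Let $R$ be a commutative ring and $A$ a cocommutative $R$-bialgebra. Let $\mathcal A^*$ be the commutative bialgebra scheme $S\mapsto \mathrm{Hom}_R(A,S)$ on commutative $R$-algebras $S$; its product is dual to the coproduct of $A$ and its coproduct is dual to the product of $A$. An element $a\in A$ is identified with the linear function $f\mapsto f(a)$ on $\mathcal A^*$, so that $A=\mathcal A^{**}(R)$. Let $\mathcal I^*=\mathrm{Ker}\,e$, where $e\colon\mathcal A^*\to\mathcal R$, $f\mapsto f(1)$, is the counit of $\mathcal A^*$, and let $\mathcal I^{*n}\subseteq\mathcal A^*$ be the module scheme closure of the $n$-th power of this ideal (with $\mathcal I^{*0}=\mathcal A^*$): $\mathcal I^{*n}(S)$ consists of all $f\in\mathrm{Hom}_R(A,S)$ that vanish on those $a\in A$ whose linear function vanishes on all $n$-fold products of elements of $\mathcal I^*$ (over all commutative $R$-algebras). Put $A_n:=(\mathcal A^*/\mathcal I^{*n+1})^*(R)\subseteq A$, the set of $a\in A$ that vanish on $\mathcal I^{*n+1}$, and $A_{-1}:=0$. The functor $\mathbb G=\mathrm{Spec}\,\mathcal A^*$, $\mathbb G(S)=\mathrm{Hom}_{\mathcal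 R\text{-}alg}(\mathcal A^*,\mathcal S)$, is a \emph{flat infinitesimal formal group} if it is a functor of groups, $A$ is a flat $R$-module, $\mathcal A^*=\varprojlim_n \mathcal A^*/\mathcal I^{*n}$ in the category of module schemes, and $(\mathcal I^{*n})_{|S}=(\mathcal I^*_{|S})^n$ for all $n$ and all base changes $R\to S$. Its tangent space is $T_e\mathbb G:=\mathrm{Der}_{\mathcal R}(\mathcal A^*,\mathcal R)\subseteq A$ (derivations at $e$), a Lie subalgebra of $A$ for the bracket $ab-ba$. For a Lie $R$-algebra $L$, the enveloping algebra $U(L)$ has the bialgebra structure for which the elements of $L$ are primitive and have counit $0$, and $U(L)_n$ denotes the image of $\bigoplus_{i\le n}L^{\otimes i}$ in $U(L)$, with $U(L)_{-1}=0$. $S^nL$ is the $n$-th symmetric power and $S_nL=(L^{\otimes n})^{S_n}$ the module of symmetric tensors; the natural morphism $S^nL\to S_nL$ is $x_1\cdots x_n\mapsto\sum_{\sigma}x_{\sigma(1)}\otimes\cdots\otimes x_{\sigma(n)}$. \textbf{Theorem.} Let $R$ be a commutative ring that is flat over $\mathbb Z$, let $\mathbb G=\mathrm{Spec}\,\mathcal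 A^*$ be a flat infinitesimal formal group, and let $L:=T_e\mathbb G$. Then: \begin{enumerate} \item The algebra morphism $U(L)\to A$ that extends the inclusion $L\subseteq A$ is an injective morphism of bialgebras, and $U(L)\otimes_{\mathbb Z}\mathbb Q\to A\otimes_{\mathbb Z}\mathbb Q$ is an isomorphism. \item This morphism maps $U(L)_n$ into $A_n$ for every $n$. For every $n\ge 0$, multiplication induces an isomorphism $S^nL\to U(L)_n/U(L)_{n-1}$, and there is an isomorphism $\gamma_n\colon A_n/A_{n-1}\to S_nL$ dual to multiplication, that is, $(f_1\cdots f_n)(a)=(f_1\otimes\cdots\otimes f_n)(\gamma_n(\bar a))$ for all commutative $R$-algebras $S$, all $f_1,\dots,f_n\in\mathcal I^*(S)$ and all $a\in A_n$. Under these isomorphisms, the morphism $U(L)_n/U(L)_{n-1}\to A_n/A_{n-1}$ is the natural morphism $S^nL\to S_nL$. It is injective, and it becomes an isomorphism after $\otimes_{\mathbb Z}\mathbb Q$. \item $L$ is the module of primitive elements of $U(L)$: the map $L\to U(L)$ is injective, and its image is the set of primitive elements. \end{enumerate} -/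

import Mathlib

open scoped TensorProduct

universe u

attribute [local instance 100] LieRing.ofAssociativeRing

namespace InfinitesimalGroup

noncomputable section

/-! ### The bialgebra scheme `𝒜^*` of a cocommutative bialgebra `A`

For a cocommutative `R`-bialgebra `A`, the commutative bialgebra scheme `𝒜^*` is the functor
`S ↦ Hom_R(A, S)` on commutative `R`-algebras. Its product is dual to the coproduct of `A`, that is,
the convolution product of `WithConv (A →ₗ[R] S)`; its coproduct is dual to the product of `A`. An
element `a : A` is a linear function on `𝒜^*`, namely `f ↦ f a` (so `A = 𝒜^{**}(R)`). -/

section Scheme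

variable (R A : Type u) [CommRing R] [Ring A] [Bialgebra R A]

/-- `a ∈ A = 𝒜^{**}(R)` is an `R`-valued point of `Spec 𝒜^*`: the linear function `f ↦ f a` is
a morphism of functors of algebras `𝒜^* → ℛ`. -/
def IsPoint (a : A) : Prop :=
  ∀ (T : Type u) [CommRing T] [Algebra R T],
    (1 : WithConv (A →ₗ[R] T)) a = 1 ∧
      ∀ f g : WithConv (A →ₗ[R] T), (f * g) a = f a * g a

/-- `a ∈ A = 𝒜^{**}(R)` is a derivation `𝒜^* → ℛ` at the unit section `e`, where
`e : 𝒜^* → ℛ`, `f ↦ f 1`, is the counit of `𝒜^*`. -/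
def IsDerivation (a : A) : Prop :=
  ∀ (T : Type u) [CommRing T] [Algebra R T] (f g : WithConv (A →ₗ[R] T)),
    (f * g) a = f a * g 1 + f 1 * g a

/-- `Spec 𝒜^*` is a functor of groups, and not only of monoids: for every base change `R → S`, each
`S`-valued point has an inverse. The points with values in `S` are elements of
`Hom_ℛ(𝒜^*, 𝒮) = S ⊗ A`, and their product is the product of `S ⊗ A`. -/
def IsGroupValued : Prop :=
  ∀ (S : Type u) [CommRing S] [Algebra R S] (x : S ⊗[R] A), IsPoint S (S ⊗[R] A) x →
    ∃ y : S ⊗[R] A, IsPoint S (S ⊗[R] A) y ∧ x * y = 1 ∧ y * x = 1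

variable [Coalgebra.IsCocomm R A]

/-- The `S`-points of the ideal `ℐ^* = Ker e`. -/
def augIdeal (S : Type u) [CommRing S] [Algebra R S] : Ideal (WithConv (A →ₗ[R] S)) where
  carrier := {f | f 1 = 0}
  add_mem' {f g} hf hg := by
    have h : (f + g) 1 = f 1 + g 1 := rfl
    simp only [Set.mem_ofPred_eq] at *
    rw [h, hf, hg, add_zero]
  zero_mem' := rfl
  smul_mem' g f hf := by
    simp only [Set.mem_ofPred_eq] at *
    simp [smul_eq_mul, LinearMap.convMul_apply, Bialgebra.comul_one,
      Algebra.TensorProduct.one_def, hf]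

/-- The linear functions on `𝒜^*` that vanish on the `n`-th power of `ℐ^*`. As a linear function
vanishes on the module scheme closure `ℐ^{*n}` exactly if it vanishes on the products themselves,
this is `(𝒜^*/ℐ^{*n})^*(R) ⊆ A`, which is `A_{n-1}` in the usual indexing (and `0` for
`n = 0`). -/
def distFil (n : ℕ) : Submodule R A where
  carrier := {a | ∀ (S : Type u) [CommRing S] [Algebra R S],
    ∀ f ∈ augIdeal R A S ^ n, f a = 0}
  add_mem' {a b} ha hb S _ _ f hf := by simp [ha S f hf, hb S f hf]
  zero_mem' S _ _ f _ := by simp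
  smul_mem' r a ha S _ _ f hf := by simp [ha S f hf]

theorem distFil_mono {m n : ℕ} (h : m ≤ n) : distFil R A m ≤ distFil R A n :=
  fun _ ha S _ _ f hf => ha S f (Ideal.pow_le_pow_right h hf)

/-- The ideal scheme `ℐ^{*n}`: the module scheme closure in `𝒜^*` of the `n`-fold products of
elements of `ℐ^*`. Submodule schemes of `𝒜^*` are the annihilators of submodules of `A`, so the
closure consists of the `f` killed by all linear functions which vanish on the products. -/
def idealSchemePow (n : ℕ) (S : Type u) [CommRing S] [Algebra R S] : Set (A →ₗ[R] S) :=
  {f | ∀ a ∈ distFil R A n, f a = 0}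

/-- `Spec 𝒜^*` is a flat infinitesimal formal monoid. -/
structure IsFlatInfinitesimalFormalMonoid : Prop where
  /-- `A` is a flat `R`-module. -/
  flat : Module.Flat R A
  /-- `𝒜^* = lim 𝒜^*/ℐ^{*n}` in the category of module schemes, where `𝒜^*/ℐ^{*n}` is the dual
  of `(𝒜^*/ℐ^{*n})^*(R)`: every compatible family comes from exactly one element of `𝒜^*`. -/
  complete : ∀ (S : Type u) [CommRing S] [Algebra R S] (g : ∀ n, distFil R A n →ₗ[R] S),
    (∀ n, g (n + 1) ∘ₗ Submodule.inclusion (distFil_mono R A n.le_succ) = g n) →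
      ∃! f : A →ₗ[R] S, ∀ n, f ∘ₗ (distFil R A n).subtype = g n
  /-- `(ℐ^{*n})_{|S} = (ℐ^*_{|S})^n` for all base changes `R → S`, as subfunctors of
  `T ↦ Hom_S(S ⊗ A, T) = Hom_R(A, T)` on commutative `S`-algebras. -/
  baseChange : ∀ (S : Type u) [CommRing S] [Algebra R S] (n : ℕ) (T : Type u) [CommRing T]
    [Algebra R T] [Algebra S T] [IsScalarTower R S T] (f : S ⊗[R] A →ₗ[S] T),
    f.restrictScalars R ∘ₗ TensorProduct.mk R S A 1 ∈ idealSchemePow R A n T ↔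
      f ∈ idealSchemePow S (S ⊗[R] A) n T

/-- `Spec 𝒜^*` is a flat infinitesimal formal group. -/
structure IsFlatInfinitesimalFormalGroup : Prop
    extends IsFlatInfinitesimalFormalMonoid R A where
  isGroupValued : IsGroupValued R A

end Scheme

/-! ### The Lie algebra `T_e 𝔾 = Der(𝒜^*, ℛ)` -/

section Tangent

variable {R A : Type u} [CommRing R] [Ring A] [Bialgebra R A]

/-- Derivations at the unit section are the primitive elements of `A`. -/
theorem isDerivation_iff (a : A) :
    IsDerivation R A a ↔ Coalgebra.comul (R := R) a = a ⊗ₜ[R] 1 + 1 ⊗ₜ[R] a := by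
  constructor
  · intro h
    let E := TrivSqZeroExt R A
    let _ : Module Rᵐᵒᵖ A := Module.compHom A ((RingHom.id R).fromOpposite mul_comm)
    have _ : IsCentralScalar R A := ⟨fun _ _ => rfl⟩
    let i : A →ₗ[R] E := TrivSqZeroExt.inrHom R A
    let p : E →ₗ[R] A := TrivSqZeroExt.sndHom R A
    have hpi : p ∘ₗ i = LinearMap.id := by
      ext x
      exact TrivSqZeroExt.snd_inr R x
    let f : WithConv (A →ₗ[R] E ⊗[R] E) := WithConv.toConv
      ((Algebra.TensorProduct.includeLeft (R := R) (S := R) (A := E) (B := E)).toLinearMap ∘ₗ i)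
    let g : WithConv (A →ₗ[R] E ⊗[R] E) := WithConv.toConv
      ((Algebra.TensorProduct.includeRight (R := R) (A := E) (B := E)).toLinearMap ∘ₗ i)
    have key := h (E ⊗[R] E) f g
    have e1 : LinearMap.mul' R (E ⊗[R] E) ∘ₗ TensorProduct.map f.ofConv g.ofConv =
        TensorProduct.map i i := by
      ext x y
      simp [f, g]
    have e2 : (f * g) a = TensorProduct.map i i (Coalgebra.comul (R := R) a) := by
      rw [← e1]; rfl
    have e3 : f a * g 1 + f 1 * g a =
        TensorProduct.map i i (a ⊗ₜ[R] 1 + 1 ⊗ₜ[R] a) := by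
      simp [f, g]
    rw [e2, e3] at key
    have hinj : ∀ z : A ⊗[R] A, TensorProduct.map p p (TensorProduct.map i i z) = z := by
      intro z
      rw [← LinearMap.comp_apply, ← TensorProduct.map_comp, hpi, TensorProduct.map_id]
      rfl
    rw [← hinj (Coalgebra.comul a), key, hinj]
  · intro h T _ _ f g
    simp [LinearMap.convMul_apply, h]

variable (R A)

/-- The tangent space `T_e 𝔾 = Der(𝒜^*, ℛ)`, with the Lie bracket `ab - ba` of `A`. -/
def tangent : LieSubalgebra R A where
  carrier := {a | IsDerivation R A a}
  add_mem' {a b} ha hb T _ _ f g := by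
    simp only [Set.mem_ofPred_eq] at *
    simp only [map_add, ha T f g, hb T f g]
    ring
  zero_mem' T _ _ f g := by simp
  smul_mem' r a ha T _ _ f g := by
    simp only [Set.mem_ofPred_eq] at *
    simp only [map_smul, ha T f g, smul_add, smul_mul_assoc, mul_smul_comm]
  lie_mem' {a b} ha hb := by
    have ha' := (isDerivation_iff a).1 ha
    have hb' := (isDerivation_iff b).1 hb
    refine (isDerivation_iff _).2 ?_
    rw [LieRing.of_associative_ring_bracket, map_sub, Bialgebra.comul_mul, Bialgebra.comul_mul,
      ha', hb']
    simp only [mul_add, add_mul, Algebra.TensorProduct.tmul_mul_tmul, mul_one, one_mul,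
      TensorProduct.sub_tmul, TensorProduct.tmul_sub]
    abel

end Tangent

/-! ### The bialgebra structure and the filtration of the enveloping algebra -/

section Enveloping

variable (R : Type u) (L : Type u) [CommRing R] [LieRing L] [LieAlgebra R L]

local notation "U" => UniversalEnvelopingAlgebra R L

/-- The coproduct of `U(L)`, with `x ↦ x ⊗ 1 + 1 ⊗ x` for `x ∈ L`. -/
def envComul : U →ₐ[R] U ⊗[R] U :=
  UniversalEnvelopingAlgebra.lift R
    { toFun x := UniversalEnvelopingAlgebra.ι R x ⊗ₜ[R] 1 +
        1 ⊗ₜ[R] UniversalEnvelopingAlgebra.ι R x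
      map_add' x y := by
        simp only [map_add, TensorProduct.add_tmul, TensorProduct.tmul_add]
        abel
      map_smul' r x := by
        simp only [map_smul, TensorProduct.smul_tmul', TensorProduct.tmul_smul, smul_add,
          RingHom.id_apply]
      map_lie' {x y} := by
        simp only [LieHom.map_lie, LieRing.of_associative_ring_bracket, mul_add, add_mul,
          Algebra.TensorProduct.tmul_mul_tmul, mul_one, one_mul, TensorProduct.sub_tmul,
          TensorProduct.tmul_sub]
        abel }

/-- The counit of `U(L)`, with `x ↦ 0` for `x ∈ L`. -/
def envCounit : U →ₐ[R] R := UniversalEnvelopingAlgebra.lift R (0 : L →ₗ⁅R⁆ R)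

theorem envComul_ι (x : L) : envComul R L (UniversalEnvelopingAlgebra.ι R x) =
    UniversalEnvelopingAlgebra.ι R x ⊗ₜ[R] 1 + 1 ⊗ₜ[R] UniversalEnvelopingAlgebra.ι R x :=
  UniversalEnvelopingAlgebra.lift_ι_apply R _ x

theorem envCounit_ι (x : L) : envCounit R L (UniversalEnvelopingAlgebra.ι R x) = 0 :=
  UniversalEnvelopingAlgebra.lift_ι_apply R _ x

/-- The standard bialgebra structure on `U(L)`, for which the elements of `L` are primitive. -/
instance : Bialgebra R U :=
  Bialgebra.ofAlgHom (envComul R L) (envCounit R L)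
    (by
      ext x
      simp [envComul_ι, -UniversalEnvelopingAlgebra.ι_apply, TensorProduct.add_tmul,
        TensorProduct.tmul_add, Algebra.TensorProduct.one_def, add_assoc])
    (by
      have h : (Algebra.TensorProduct.lid R U).toAlgHom.comp
          ((Algebra.TensorProduct.map (envCounit R L) (.id R U)).comp (envComul R L)) =
            .id R U := by
        refine UniversalEnvelopingAlgebra.hom_ext _ (LieHom.ext fun x => ?_)
        simp [envComul_ι, envCounit_ι, -UniversalEnvelopingAlgebra.ι_apply]
      exact AlgHom.ext fun u => (Algebra.TensorProduct.lid R U).injective <|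
        (DFunLike.congr_fun h u).trans ((Algebra.TensorProduct.lid R U).apply_symm_apply u).symm)
    (by
      refine UniversalEnvelopingAlgebra.hom_ext _ (LieHom.ext fun x => ?_)
      simp [envComul_ι, envCounit_ι, -UniversalEnvelopingAlgebra.ι_apply])

/-- The image of `⨁_{i < n} T^i L` in `U(L)`, which is `U(L)_{n-1}` in the usual indexing (and `0`
for `n = 0`). -/
def envFil (n : ℕ) : Submodule R U :=
  ⨆ i < n, LinearMap.range (UniversalEnvelopingAlgebra.ι R : L →ₗ⁅R⁆ U).toLinearMap ^ i

variable {L} in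
theorem prod_mem_envFil {n : ℕ} (x : Fin n → L) :
    (List.ofFn fun i => (UniversalEnvelopingAlgebra.ι R (x i) : U)).prod ∈
      envFil R L (n + 1) := by
  refine Submodule.mem_iSup_of_mem n (Submodule.mem_iSup_of_mem n.lt_succ_self ?_)
  induction n with
  | zero => exact ⟨1, by simp⟩
  | succ n ih =>
    rw [List.ofFn_succ, List.prod_cons, pow_succ']
    exact Submodule.mul_mem_mul ⟨x 0, rfl⟩ (ih fun i => x i.succ)

end Enveloping

/-! ### Graded pieces, symmetric powers and symmetric tensors -/

section Graded

variable {R M N : Type u} [CommRing R] [AddCommGroup M] [Module R M] [AddCommGroup N] [Module R N]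

/-- The `n`-th graded piece `F (n + 1) / F n` of an increasing filtration. -/
abbrev Gr (F : ℕ → Submodule R M) (n : ℕ) : Type u := F (n + 1) ⧸ (F n).submoduleOf (F (n + 1))

/-- The map of graded pieces induced by a filtered linear map. -/
def grMap {F : ℕ → Submodule R M} {G : ℕ → Submodule R N} (φ : M →ₗ[R] N)
    (h : ∀ n, F n ≤ (G n).comap φ) (n : ℕ) : Gr F n →ₗ[R] Gr G n :=
  Submodule.mapQ _ _ (φ.restrict (h (n + 1))) fun _ hx => h n hx

/-- `φ ⊗_ℤ ℚ`. -/
def tensorRat (φ : M →ₗ[R] N) : M ⊗[ℤ] ℚ →ₗ[ℤ] N ⊗[ℤ] ℚ :=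
  LinearMap.rTensor ℚ φ.toAddMonoidHom.toIntLinearMap

variable (R M)

/-- The submodule of `M^{⊗n}` that is divided out in the symmetric power. -/
def symRel (n : ℕ) : Submodule R (⨂[R]^n M) :=
  Submodule.span R {t | ∃ (x : Fin n → M) (σ : Equiv.Perm (Fin n)),
    t = PiTensorProduct.tprod R x - PiTensorProduct.tprod R fun i => x (σ i)}

/-- The `n`-th symmetric power `S^n M`, the coinvariants of `M^{⊗n}` (Mathlib's `SymmetricPower`
requires `R` and the index set to live in the same universe). -/
abbrev SymPow (n : ℕ) : Type u := (⨂[R]^n M) ⧸ symRel R M n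

/-- The module `S_n M = (M^{⊗n})^{S_n}` of symmetric tensors. -/
def symTensors (n : ℕ) : Submodule R (⨂[R]^n M) where
  carrier := {t | ∀ σ : Equiv.Perm (Fin n), PiTensorProduct.reindex R (fun _ => M) σ t = t}
  add_mem' {s t} hs ht σ := by
    have hs' := hs σ
    have ht' := ht σ
    rw [map_add, hs', ht']
  zero_mem' σ := map_zero _
  smul_mem' r t ht σ := by
    have ht' := ht σ
    rw [map_smul, ht']

variable {R M}

/-- The product `x_1 ⋯ x_n` in `S^n M`. -/
def symProd {n : ℕ} (x : Fin n → M) : SymPow R M n :=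
  Submodule.Quotient.mk (PiTensorProduct.tprod R x)

/-- `t ↦ ∑_σ σ t` on `M^{⊗n}`. -/
def sumPerm (n : ℕ) : (⨂[R]^n M) →ₗ[R] ⨂[R]^n M :=
  ∑ σ : Equiv.Perm (Fin n), (PiTensorProduct.reindex R (fun _ => M) σ).toLinearMap

theorem sumPerm_tprod {n : ℕ} (x : Fin n → M) :
    sumPerm (R := R) n (PiTensorProduct.tprod R x) =
      ∑ σ : Equiv.Perm (Fin n), PiTensorProduct.tprod R fun i => x (σ i) := by
  simp only [sumPerm, LinearMap.sum_apply, LinearEquiv.coe_coe]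
  rw [← Equiv.sum_comp (Equiv.inv (Equiv.Perm (Fin n)))]
  exact Finset.sum_congr rfl fun σ _ => PiTensorProduct.reindex_tprod _ _

theorem sumPerm_mem (n : ℕ) (t : ⨂[R]^n M) : sumPerm n t ∈ symTensors R M n := by
  intro τ
  simp only [sumPerm, LinearMap.sum_apply, map_sum, LinearEquiv.coe_coe]
  conv_rhs => rw [← Equiv.sum_comp (Equiv.mulLeft τ)]
  exact Finset.sum_congr rfl fun σ _ => PiTensorProduct.reindex_reindex (R := R) σ τ t

/-- The natural morphism `S^n M → S_n M`, `x_1 ⋯ x_n ↦ ∑_σ x_{σ(1)} ⊗ ⋯ ⊗ x_{σ(n)}`. -/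
def symMap (n : ℕ) : SymPow R M n →ₗ[R] symTensors R M n :=
  (symRel R M n).liftQ ((sumPerm n).codRestrict _ (sumPerm_mem n)) <| by
    refine Submodule.span_le.2 ?_
    rintro _ ⟨x, τ, rfl⟩
    refine LinearMap.mem_ker.2 (Subtype.ext ?_)
    rw [map_sub]
    refine congrArg Subtype.val (sub_eq_zero.2 (Subtype.ext ?_))
    simp only [LinearMap.codRestrict_apply, sumPerm_tprod]
    rw [← Equiv.sum_comp (Equiv.mulLeft τ)]
    rfl

/-- For linear maps `f_1, …, f_n` from a module containing `M` to an algebra `S`, the linear map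
`M^{⊗n} → S`, `x_1 ⊗ ⋯ ⊗ x_n ↦ f_1(x_1) ⋯ f_n(x_n)`. -/
def prodPairing {n : ℕ} {S : Type u} [CommRing S] [Algebra R S] (f : Fin n → (M →ₗ[R] S)) :
    (⨂[R]^n M) →ₗ[R] S :=
  PiTensorProduct.lift ((MultilinearMap.mkPiAlgebra R (Fin n) S).compLinearMap f)

end Graded

end

end InfinitesimalGroup

namespace InfinitesimalGroup

noncomputable section

section TensorPowers

variable {R M N : Type u} [CommRing R] [AddCommGroup M] [Module R M] [AddCommGroup N] [Module R N]

variable (R M) in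
/-- The isomorphism `M ⊗ M^{⊗n} ≃ M^{⊗(n+1)}`. -/
def tensorCons (n : ℕ) : M ⊗[R] (⨂[R]^n M) ≃ₗ[R] ⨂[R]^(n + 1) M :=
  LinearEquiv.ofLinearMap
    (TensorProduct.lift ((PiTensorProduct.lift (R := R) (s := fun _ : Fin n => M)).toLinearMap ∘ₗ
      (PiTensorProduct.tprod R (s := fun _ : Fin (n + 1) => M)).curryLeft))
    (PiTensorProduct.lift (LinearMap.uncurryLeft
      { toFun x := (TensorProduct.mk R M (⨂[R]^n M) x).compMultilinearMap
          (PiTensorProduct.tprod R)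
        map_add' x y := by ext v; simp
        map_smul' r x := by ext v; simp [TensorProduct.smul_tmul'] }))
    (by
      ext v
      simp)
    (by
      ext x v
      simp)

@[simp]
theorem tensorCons_tmul_tprod {n : ℕ} (x : M) (v : Fin n → M) :
    tensorCons R M n (x ⊗ₜ PiTensorProduct.tprod R v) =
      PiTensorProduct.tprod R (Fin.cons x v : Fin (n + 1) → M) := by
  simp [tensorCons]

theorem map_comp_tensorCons {n : ℕ} (f : M →ₗ[R] N) :
    PiTensorProduct.map (fun _ : Fin (n + 1) => f) ∘ₗ (tensorCons R M n).toLinearMap =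
      (tensorCons R N n).toLinearMap ∘ₗ
        TensorProduct.map f (PiTensorProduct.map (fun _ : Fin n => f)) := by
  ext x v
  simp only [LinearMap.compMultilinearMap_apply, TensorProduct.AlgebraTensorModule.curry_apply,
    TensorProduct.curry_apply, LinearMap.coe_comp, LinearEquiv.coe_coe, Function.comp_apply,
    LinearMap.restrictScalars_self, tensorCons_tmul_tprod, PiTensorProduct.map_tprod,
    TensorProduct.map_tmul]
  congr 1
  ext i
  refine Fin.cases ?_ (fun j => ?_) i <;> simp

theorem prodPairing_tprod {n : ℕ} {S : Type u} [CommRing S] [Algebra R S]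
    (f : Fin n → (M →ₗ[R] S)) (x : Fin n → M) :
    prodPairing f (PiTensorProduct.tprod R x) = ∏ i, f i (x i) := by
  simp [prodPairing]

theorem prodPairing_comp_tensorCons {n : ℕ} {S : Type u} [CommRing S] [Algebra R S]
    (f : Fin (n + 1) → (M →ₗ[R] S)) :
    prodPairing f ∘ₗ (tensorCons R M n).toLinearMap =
      LinearMap.mul' R S ∘ₗ TensorProduct.map (f 0) (prodPairing fun i => f i.succ) := by
  ext x v
  simp [prodPairing_tprod, Fin.prod_univ_succ]

theorem prodPairing_comp_map {n : ℕ} {S : Type u} [CommRing S] [Algebra R S]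
    (f : Fin n → (N →ₗ[R] S)) (g : M →ₗ[R] N) :
    prodPairing f ∘ₗ PiTensorProduct.map (fun _ : Fin n => g) =
      prodPairing fun i => f i ∘ₗ g := by
  ext x
  simp [prodPairing_tprod]

theorem prodPairing_reindex {n : ℕ} {S : Type u} [CommRing S] [Algebra R S]
    (f : Fin n → (M →ₗ[R] S)) (σ : Equiv.Perm (Fin n)) (t : ⨂[R]^n M) :
    prodPairing f (PiTensorProduct.reindex R (fun _ => M) σ t) =
      prodPairing (fun i => f (σ i)) t := by
  suffices h : prodPairing f ∘ₗ (PiTensorProduct.reindex R (fun _ => M) σ).toLinearMap =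
      prodPairing (fun i => f (σ i)) from DFunLike.congr_fun h t
  ext x
  have h : PiTensorProduct.reindex R (fun _ => M) σ (PiTensorProduct.tprod R x) =
    PiTensorProduct.tprod R fun i => x (σ.symm i) := PiTensorProduct.reindex_tprod _ _
  simp only [LinearMap.compMultilinearMap_apply, LinearMap.coe_comp, LinearEquiv.coe_coe,
    Function.comp_apply, prodPairing_tprod, h]
  exact (Fintype.prod_equiv σ _ _ fun i => by rw [σ.symm_apply_apply]).symm

/-- The linear functions `prodPairing f` separate the elements of `M^{⊗n}`. -/
theorem ext_prodPairing {n : ℕ} {s t : ⨂[R]^n M}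
    (h : ∀ (S : Type u) [CommRing S] [Algebra R S] (f : Fin n → (M →ₗ[R] S)),
      prodPairing f s = prodPairing f t) : s = t := by
  let _ : Module Rᵐᵒᵖ M := Module.compHom M ((RingHom.id R).fromOpposite mul_comm)
  have _ : IsCentralScalar R M := ⟨fun _ _ => rfl⟩
  let E := TrivSqZeroExt R M
  let f : Fin n → (M →ₗ[R] ⨂[R]^n E) := fun i =>
    (PiTensorProduct.singleAlgHom (R := R) (A := fun _ : Fin n => E) i).toLinearMap ∘ₗ
      TrivSqZeroExt.inrHom R M
  have hf : prodPairing f = PiTensorProduct.map (fun _ : Fin n => TrivSqZeroExt.inrHom R M) := by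
    ext x
    simp only [LinearMap.compMultilinearMap_apply, prodPairing_tprod, PiTensorProduct.map_tprod, f,
      LinearMap.comp_apply, AlgHom.toLinearMap_apply, PiTensorProduct.singleAlgHom_apply]
    have := map_prod (PiTensorProduct.tprodMonoidHom (A := fun _ : Fin n => E) R)
      (fun i => MonoidHom.mulSingle (fun _ : Fin n => E) i (TrivSqZeroExt.inrHom R M (x i)))
      Finset.univ
    refine this.symm.trans ?_
    simp only [PiTensorProduct.tprodMonoidHom_apply]
    congr 1
    exact Finset.univ_prod_mulSingle (M := fun _ : Fin n => E) fun i => TrivSqZeroExt.inrHom R M (x i)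
  have key := h (⨂[R]^n E) f
  rw [hf] at key
  have hinj : ∀ z : ⨂[R]^n M, PiTensorProduct.map (fun _ : Fin n => TrivSqZeroExt.sndHom R M)
      (PiTensorProduct.map (fun _ : Fin n => TrivSqZeroExt.inrHom R M) z) = z := by
    intro z
    rw [← LinearMap.comp_apply, ← PiTensorProduct.map_comp]
    have : (fun _ : Fin n => TrivSqZeroExt.sndHom R M ∘ₗ TrivSqZeroExt.inrHom R M) =
        fun _ => LinearMap.id := by
      funext _
      ext x
      rfl
    rw [this, PiTensorProduct.map_id]
    rfl
  rw [← hinj s, key, hinj]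

theorem flat_tensorPower [Module.Flat R M] (n : ℕ) : Module.Flat R (⨂[R]^n M) := by
  induction n with
  | zero => exact Module.Flat.of_linearEquiv (PiTensorProduct.isEmptyEquiv (R := R) (Fin 0))
  | succ n ih => exact Module.Flat.of_linearEquiv (tensorCons R M n).symm

theorem map_tensorPower_injective [Module.Flat R M] [Module.Flat R N] {f : M →ₗ[R] N}
    (hf : Function.Injective f) (n : ℕ) :
    Function.Injective (PiTensorProduct.map (R := R) (fun _ : Fin n => f)) := by
  induction n with
  | zero =>
    refine Function.Injective.of_comp_iff' _ (LinearEquiv.bijective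
      (PiTensorProduct.isEmptyEquiv (R := R) (s := fun _ : Fin 0 => M) (Fin 0)).symm) |>.1 ?_
    refine Function.Injective.of_comp (f := PiTensorProduct.isEmptyEquiv (R := R) (Fin 0)) ?_
    convert Function.injective_id
    ext r
    simp [PiTensorProduct.isEmptyEquiv]
  | succ n ih =>
    have := flat_tensorPower (R := R) (M := M) n
    have := flat_tensorPower (R := R) (M := N) n
    have h := map_comp_tensorCons (n := n) f
    refine Function.Injective.of_comp_iff' _ (tensorCons R M n).bijective |>.1 ?_
    have h' : ⇑(PiTensorProduct.map (fun _ : Fin (n + 1) => f)) ∘ ⇑(tensorCons R M n) =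
      ⇑(tensorCons R N n) ∘ ⇑(TensorProduct.map f (PiTensorProduct.map (fun _ : Fin n => f))) :=
      congrArg DFunLike.coe h
    rw [h']
    refine (tensorCons R N n).injective.comp ?_
    exact TensorProduct.map_injective_of_flat_flat' _ _ hf ih

theorem isAddTorsionFree_of_flat (R : Type u) {M : Type u} [CommRing R] [Module.Flat ℤ R]
    [AddCommGroup M] [Module R M] [Module.Flat R M] : IsAddTorsionFree M := by
  have : Module.Flat ℤ M := Module.Flat.trans ℤ R M
  exact Module.isTorsionFree_int_iff_isAddTorsionFree.1 inferInstance

end TensorPowers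

section SymmetricPowers

variable {R M N P : Type u} [CommRing R] [AddCommGroup M] [Module R M] [AddCommGroup N] [Module R N]
  [AddCommGroup P] [Module R P]

variable (R) in
theorem isAddTorsionFree_of_natCast_smul
    (h : ∀ k : ℕ, k ≠ 0 → ∀ x : M, (k : R) • x = 0 → x = 0) : IsAddTorsionFree M := by
  refine ⟨fun k hk x y (hxy : k • x = k • y) => sub_eq_zero.1 (h k hk _ ?_)⟩
  rw [Nat.cast_smul_eq_nsmul, smul_sub, hxy, sub_self]

theorem eq_zero_of_natCast_smul_eq_zero [IsAddTorsionFree M] {k : ℕ} (hk : k ≠ 0) {x : M}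
    (h : (k : R) • x = 0) : x = 0 := by
  rw [Nat.cast_smul_eq_nsmul] at h
  exact (nsmul_eq_zero_iff_right hk).1 h

theorem symPow_hom_ext {n : ℕ} {f g : SymPow R M n →ₗ[R] N}
    (h : ∀ x : Fin n → M, f (symProd x) = g (symProd x)) : f = g := by
  refine Submodule.linearMap_qext _ (PiTensorProduct.ext (MultilinearMap.ext fun x => h x))

theorem symPow_induction {n : ℕ} {p : SymPow R M n → Prop}
    (add : ∀ s t, p s → p t → p (s + t)) (smul : ∀ (r : R) (x : Fin n → M), p (r • symProd x))
    (t : SymPow R M n) : p t := by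
  obtain ⟨t, rfl⟩ := Submodule.mkQ_surjective _ t
  induction t using PiTensorProduct.induction_on with
  | smul_tprod r x => exact smul r x
  | add s t hs ht => rw [map_add]; exact add _ _ hs ht

/-- A symmetric multilinear map descends to the symmetric power. -/
def symPowLift {n : ℕ} (f : MultilinearMap R (fun _ : Fin n => M) N)
    (hf : ∀ (x : Fin n → M) (σ : Equiv.Perm (Fin n)), f x = f fun i => x (σ i)) :
    SymPow R M n →ₗ[R] N :=
  (symRel R M n).liftQ (PiTensorProduct.lift f) <| by
    refine Submodule.span_le.2 ?_
    rintro _ ⟨x, σ, rfl⟩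
    simp [← hf x σ]

@[simp]
theorem symPowLift_symProd {n : ℕ} (f : MultilinearMap R (fun _ : Fin n => M) N)
    (hf : ∀ (x : Fin n → M) (σ : Equiv.Perm (Fin n)), f x = f fun i => x (σ i))
    (x : Fin n → M) : symPowLift f hf (symProd x) = f x :=
  PiTensorProduct.lift.tprod x

theorem symProd_comp_perm {n : ℕ} (x : Fin n → M) (σ : Equiv.Perm (Fin n)) :
    symProd (R := R) (fun i => x (σ i)) = symProd x :=
  Eq.symm ((Submodule.Quotient.eq _).2 (Submodule.subset_span ⟨x, σ, rfl⟩ : _ ∈ symRel R M n))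

variable (R M) in
/-- The symmetric multilinear map `x ↦ x_1 ⋯ x_n`. -/
def symProdMultilinear (n : ℕ) : MultilinearMap R (fun _ : Fin n => M) (SymPow R M n) :=
  (symRel R M n).mkQ.compMultilinearMap (PiTensorProduct.tprod R)

@[simp]
theorem symProdMultilinear_apply {n : ℕ} (x : Fin n → M) :
    symProdMultilinear R M n x = symProd x := rfl

/-- The map of symmetric powers induced by a linear map. -/
def symPowMap (n : ℕ) (f : M →ₗ[R] N) : SymPow R M n →ₗ[R] SymPow R N n :=
  symPowLift ((symProdMultilinear R N n).compLinearMap fun _ => f) fun x σ => by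
    simpa using (symProd_comp_perm (R := R) (fun i => f (x i)) σ).symm

@[simp]
theorem symPowMap_symProd {n : ℕ} (f : M →ₗ[R] N) (x : Fin n → M) :
    symPowMap n f (symProd x) = symProd fun i => f (x i) := by
  rw [symPowMap, symPowLift_symProd]
  rfl

theorem symPowMap_comp (n : ℕ) (g : N →ₗ[R] P) (f : M →ₗ[R] N) :
    symPowMap n (g ∘ₗ f) = symPowMap n g ∘ₗ symPowMap n f :=
  symPow_hom_ext fun x => by simp

theorem symPow_isAddTorsionFree_of_free [IsAddTorsionFree R] [Module.Free R M] (n : ℕ) :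
    IsAddTorsionFree (SymPow R M n) := by
  let ι := Module.Free.ChooseBasisIndex R M
  let b := Module.Free.chooseBasis R M
  let W : Setoid (Fin n → ι) :=
    { r φ φ' := ∃ σ : Equiv.Perm (Fin n), φ ∘ σ = φ'
      iseqv :=
        { refl φ := ⟨1, rfl⟩
          symm := by
            rintro φ _ ⟨σ, rfl⟩
            exact ⟨σ.symm, by ext; simp⟩
          trans := by
            rintro φ _ _ ⟨σ, rfl⟩ ⟨τ, rfl⟩
            exact ⟨τ.trans σ, rfl⟩ } }
  let q : (Fin n → ι) → Quotient W := Quotient.mk W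
  have hq : ∀ φ (σ : Equiv.Perm (Fin n)), q (fun i => φ (σ i)) = q φ := fun φ σ =>
    (Quotient.sound ⟨σ, rfl⟩ : q φ = q fun i => φ (σ i)).symm
  let B := Basis.piTensorProduct fun _ : Fin n => b
  let c : (⨂[R]^n M) →ₗ[R] (Quotient W →₀ R) := B.constr R fun φ => Finsupp.single (q φ) 1
  have hc : ∀ φ : Fin n → ι, c (PiTensorProduct.tprod R fun i => b (φ i)) =
      Finsupp.single (q φ) 1 := by
    intro φ
    rw [← Basis.piTensorProduct_apply]
    exact B.constr_basis R _ φ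
  have hcσ : ∀ σ : Equiv.Perm (Fin n),
      c ∘ₗ (PiTensorProduct.reindex R (fun _ => M) σ).toLinearMap = c := by
    intro σ
    refine B.ext fun φ => ?_
    have h : PiTensorProduct.reindex R (fun _ => M) σ (PiTensorProduct.tprod R fun i => b (φ i)) =
      PiTensorProduct.tprod R fun i => b (φ (σ.symm i)) := PiTensorProduct.reindex_tprod _ _
    simp only [B, Basis.piTensorProduct_apply, LinearMap.comp_apply, LinearEquiv.coe_coe, h, hc]
    rw [hq φ σ.symm]
  let C : SymPow R M n →ₗ[R] (Quotient W →₀ R) :=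
    symPowLift (c.compMultilinearMap (PiTensorProduct.tprod R)) fun x σ => by
      have h : PiTensorProduct.reindex R (fun _ => M) σ.symm (PiTensorProduct.tprod R x) =
        PiTensorProduct.tprod R fun i => x (σ i) := PiTensorProduct.reindex_tprod _ _
      simp only [LinearMap.compMultilinearMap_apply, ← h]
      exact (DFunLike.congr_fun (hcσ σ.symm) _).symm
  let D : (Quotient W →₀ R) →ₗ[R] SymPow R M n :=
    Finsupp.linearCombination R fun s => symProd fun i => b (s.out i)
  have hD : ∀ φ : Fin n → ι, D (Finsupp.single (q φ) 1) = symProd fun i => b (φ i) := by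
    intro φ
    obtain ⟨σ, hσ⟩ : ∃ σ : Equiv.Perm (Fin n), (q φ).out ∘ σ = φ :=
      Quotient.exact (Quotient.out_eq (q φ))
    rw [Finsupp.linearCombination_single, one_smul, ← symProd_comp_perm _ σ]
    exact congrArg symProd (funext fun i => congrArg b (congrFun hσ i))
  have hDC : D ∘ₗ C = LinearMap.id := by
    refine Submodule.linearMap_qext _ (B.ext fun φ => ?_)
    simp only [B, Basis.piTensorProduct_apply, LinearMap.comp_apply]
    change D (C (symProd fun i => b (φ i))) = symProd fun i => b (φ i)
    rw [← hD φ]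
    refine congrArg D ?_
    rw [hD φ, symPowLift_symProd]
    exact hc φ
  refine Function.Injective.isAddTorsionFree C.toAddMonoidHom ?_
  exact Function.LeftInverse.injective (g := D) (DFunLike.congr_fun hDC)

/-- A linear relation in a flat module already holds in a free module mapping to it. -/
theorem exists_free_factorization [Module.Flat R M] {F : Type u} [AddCommGroup F] [Module R F]
    [Module.Free R F] (p : F →ₗ[R] M) {k : F} (hk : p k = 0) :
    ∃ (G : Type u) (_ : AddCommGroup G) (_ : Module R G) (_ : Module.Free R G)
      (a : F →ₗ[R] G) (y : G →ₗ[R] M), p = y ∘ₗ a ∧ a k = 0 := by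
  classical
  let b := Module.Free.chooseBasis R F
  let c := b.repr k
  have hc : ∑ i : c.support, c i • p (b i) = 0 := by
    rw [Finset.sum_coe_sort c.support (fun i => c i • p (b i)), ← hk,
      ← b.linearCombination_repr k, Finsupp.linearCombination_apply, Finsupp.sum, map_sum]
    simp [c]
  obtain ⟨κ, d, y, h1, h2⟩ := Module.Flat.isTrivialRelation_of_sum_smul_eq_zero hc
  let a : F →ₗ[R] F × (Fin κ → R) := b.constr R fun i =>
    if h : i ∈ c.support then (0, d ⟨i, h⟩) else (b i, 0)
  have ha : ∀ i : c.support, a (b i) = (0, d i) := fun i => by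
    rw [b.constr_basis, dif_pos i.2]
  have ha' : ∀ i ∉ c.support, a (b i) = (b i, 0) := fun i h => by
    rw [b.constr_basis, dif_neg h]
  refine ⟨F × (Fin κ → R), inferInstance, inferInstance, inferInstance, a,
    p.coprod (Fintype.linearCombination R y), b.ext fun i => ?_, ?_⟩
  · by_cases h : i ∈ c.support
    · rw [LinearMap.comp_apply, ha ⟨i, h⟩, LinearMap.coprod_apply, map_zero, zero_add,
        Fintype.linearCombination_apply]
      exact h1 ⟨i, h⟩
    · simp [ha' i h]
  · have h : a k = ∑ i : c.support, ((0, c i • d i) : F × (Fin κ → R)) := by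
      rw [← b.linearCombination_repr k, Finsupp.linearCombination_apply, Finsupp.sum, map_sum,
        ← Finset.sum_coe_sort]
      refine Finset.sum_congr rfl fun i _ => ?_
      rw [map_smul, ha, Prod.smul_mk, smul_zero]
    rw [h]
    refine Prod.ext (by simp [Prod.fst_sum]) (funext fun j => ?_)
    simpa [Prod.snd_sum] using h2 j

theorem exists_free_factorization_finset [Module.Flat R M] {N : Type u} (s : Finset N) :
    ∀ {F : Type u} [AddCommGroup F] [Module R F] [Module.Free R F] (p : F →ₗ[R] M)
      (j : N → F) (_ : ∀ k ∈ s, p (j k) = 0),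
    ∃ (G : Type u) (_ : AddCommGroup G) (_ : Module R G) (_ : Module.Free R G)
      (a : F →ₗ[R] G) (y : G →ₗ[R] M), p = y ∘ₗ a ∧ ∀ k ∈ s, a (j k) = 0 := by
  classical
  induction s using Finset.induction_on with
  | empty => exact fun {F} _ _ _ p _ _ => ⟨F, _, _, ‹_›, .id, p, rfl, by simp⟩
  | insert k s _ ih =>
    intro F _ _ _ p j h
    obtain ⟨G, _, _, _, a, y, rfl, ha⟩ := exists_free_factorization p (h k (by simp))
    obtain ⟨G', _, _, _, a', y', rfl, ha'⟩ := ih y (a ∘ j) fun l hl => h l (by simp [hl])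
    refine ⟨G', _, _, ‹_›, a' ∘ₗ a, y', rfl, fun l hl => ?_⟩
    obtain rfl | hl := Finset.mem_insert.1 hl
    · simp [ha]
    · exact ha' l hl

theorem MultilinearMap.eq_of_sub_mem {n : ℕ} (K : Submodule R M)
    (f : MultilinearMap R (fun _ : Fin n => M) N) (hf : ∀ x i, x i ∈ K → f x = 0)
    {x y : Fin n → M} (h : ∀ i, x i - y i ∈ K) : f x = f y := by
  classical
  have hx : x = (x - y) + y := by simp
  rw [hx, f.map_add_univ, Finset.sum_eq_single ∅]
  · simp
  · intro s _ hs
    obtain ⟨i, hi⟩ := Finset.nonempty_iff_ne_empty.2 hs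
    exact hf _ i (by simpa [hi] using h i)
  · simp

theorem symPow_isAddTorsionFree [IsAddTorsionFree R] [Module.Flat R M] (n : ℕ) :
    IsAddTorsionFree (SymPow R M n) := by
  classical
  let F := M →₀ R
  let p : F →ₗ[R] M := Finsupp.linearCombination R id
  let s : M → F := fun x => Finsupp.single x 1
  have hs : ∀ x, p (s x) = x := fun x => (Finsupp.linearCombination_single R _ _).trans (one_smul R x)
  let K := LinearMap.ker p
  let W : Submodule R (SymPow R F n) :=
    Submodule.span R {t | ∃ x : Fin n → F, (∃ i, x i ∈ K) ∧ t = symProd x}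
  let mW := W.mkQ.compMultilinearMap (symProdMultilinear R F n)
  have hW : ∀ x i, x i ∈ K → mW x = 0 := fun x i hi =>
    (Submodule.Quotient.mk_eq_zero W).2 (Submodule.subset_span ⟨x, ⟨i, hi⟩, rfl⟩)
  let m : MultilinearMap R (fun _ : Fin n => M) (SymPow R F n ⧸ W) := MultilinearMap.mk'
    (fun x => mW fun i => s (x i))
    (fun x i a b => by
      have h : ∀ c : M, (fun j => s (Function.update x i c j)) =
          Function.update (fun j => s (x j)) i (s c) := fun c => by
        ext1 j
        by_cases hj : j = i
        · subst hj; simp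
        · simp [hj]
      simp only [h]
      rw [← mW.map_update_add]
      refine MultilinearMap.eq_of_sub_mem K mW hW fun j => ?_
      by_cases hj : j = i
      · subst hj; simp [K, hs]
      · simp [hj])
    (fun x i r a => by
      have h : ∀ c : M, (fun j => s (Function.update x i c j)) =
          Function.update (fun j => s (x j)) i (s c) := fun c => by
        ext1 j
        by_cases hj : j = i
        · subst hj; simp
        · simp [hj]
      simp only [h]
      rw [← mW.map_update_smul]
      refine MultilinearMap.eq_of_sub_mem K mW hW fun j => ?_
      by_cases hj : j = i
      · subst hj; simp [K, hs]
      · simp [hj])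
  let ψ : SymPow R M n →ₗ[R] SymPow R F n ⧸ W := symPowLift m fun x σ =>
    congrArg W.mkQ (symProd_comp_perm (fun i => s (x i)) σ).symm
  have hψ : ψ ∘ₗ symPowMap n p = W.mkQ := by
    refine symPow_hom_ext fun x => ?_
    rw [LinearMap.comp_apply, symPowMap_symProd]
    refine (symPowLift_symProd _ _ _).trans ?_
    exact MultilinearMap.eq_of_sub_mem (y := x) (x := fun i => s (p (x i))) K mW hW
      fun j => by simp [K, hs]
  have hsurj : Function.Surjective (symPowMap n p) := by
    intro t
    induction t using symPow_induction with
    | add a b ha hb =>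
      obtain ⟨a, rfl⟩ := ha
      obtain ⟨b, rfl⟩ := hb
      exact ⟨a + b, map_add _ _ _⟩
    | smul r x => exact ⟨r • symProd fun i => s (x i), by simp [hs]⟩
  have hfin : ∀ w ∈ W, ∃ S : Finset F, (∀ k ∈ S, p k = 0) ∧
      ∀ (G : Type u) [AddCommGroup G] [Module R G] (a : F →ₗ[R] G), (∀ k ∈ S, a k = 0) →
        symPowMap n a w = 0 := by
    intro w hw
    induction hw using Submodule.span_induction with
    | mem w hw =>
      obtain ⟨x, ⟨i, hi⟩, rfl⟩ := hw
      refine ⟨{x i}, fun k hk => Finset.mem_singleton.1 hk ▸ hi, fun G _ _ a ha => ?_⟩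
      rw [symPowMap_symProd, ← symProdMultilinear_apply]
      exact (symProdMultilinear R G n).map_coord_zero i (ha _ (by simp))
    | zero => exact ⟨∅, by simp, fun G _ _ a _ => map_zero _⟩
    | add v w _ _ hv hw =>
      obtain ⟨S, hS, h⟩ := hv
      obtain ⟨S', hS', h'⟩ := hw
      refine ⟨S ∪ S', fun k hk => (Finset.mem_union.1 hk).elim (hS k) (hS' k),
        fun G _ _ a ha => ?_⟩
      rw [map_add, h G a fun k hk => ha k (Finset.mem_union_left _ hk),
        h' G a fun k hk => ha k (Finset.mem_union_right _ hk), add_zero]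
    | smul r w _ hw =>
      obtain ⟨S, hS, h⟩ := hw
      exact ⟨S, hS, fun G _ _ a ha => by rw [map_smul, h G a ha, smul_zero]⟩
  refine isAddTorsionFree_of_natCast_smul R fun k hk t ht => ?_
  obtain ⟨t, rfl⟩ := hsurj t
  have h1 : (k : R) • t ∈ W := by
    rw [← map_smul] at ht
    rw [← Submodule.Quotient.mk_eq_zero, ← Submodule.mkQ_apply, ← hψ, LinearMap.comp_apply, ht,
      map_zero]
  obtain ⟨S, hS, h⟩ := hfin _ h1
  obtain ⟨G, _, _, _, a, y, hp, ha⟩ := exists_free_factorization_finset S p id hS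
  have := symPow_isAddTorsionFree_of_free (R := R) (M := G) n
  have h2 := h G a ha
  rw [map_smul] at h2
  rw [hp, symPowMap_comp, LinearMap.comp_apply, eq_zero_of_natCast_smul_eq_zero hk h2, map_zero]

/-- The map `S^n M → S_n M` followed by `S_n M → S^n M` is the multiplication by `n!`. -/
theorem symMap_factorial {n : ℕ} (t : SymPow R M n) :
    (symRel R M n).mkQ (symMap (R := R) (M := M) n t : ⨂[R]^n M) = (n.factorial : R) • t := by
  suffices h : (symRel R M n).mkQ ∘ₗ (symTensors R M n).subtype ∘ₗ symMap n =
      (n.factorial : R) • LinearMap.id from DFunLike.congr_fun h t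
  refine symPow_hom_ext fun x => ?_
  have h : ((symMap (R := R) (M := M) n (symProd x) : symTensors R M n) : ⨂[R]^n M) =
    sumPerm n (PiTensorProduct.tprod R x) := rfl
  simp only [LinearMap.comp_apply, Submodule.subtype_apply, h, sumPerm_tprod, map_sum]
  have h2 : ∀ σ : Equiv.Perm (Fin n), (symRel R M n).mkQ
      (PiTensorProduct.tprod R fun i => x (σ i)) = symProd x := fun σ => symProd_comp_perm x σ
  simp [h2, Fintype.card_perm, Nat.cast_smul_eq_nsmul]

theorem symMap_injective [IsAddTorsionFree R] [Module.Flat R M] (n : ℕ) :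
    Function.Injective (symMap n : SymPow R M n →ₗ[R] _) := by
  have := symPow_isAddTorsionFree (R := R) (M := M) n
  refine (injective_iff_map_eq_zero _).2 fun t ht => ?_
  have h := symMap_factorial t
  rw [ht] at h
  exact eq_zero_of_natCast_smul_eq_zero n.factorial_ne_zero (h.symm.trans (map_zero _))

/-- The map `S_n M → S^n M` followed by `S^n M → S_n M` is the multiplication by `n!`. -/
theorem symMap_mkQ {n : ℕ} (t : symTensors R M n) :
    symMap (R := R) (M := M) n ((symRel R M n).mkQ (t : ⨂[R]^n M)) = (n.factorial : R) • t := by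
  refine Subtype.ext ?_
  change sumPerm n (t : ⨂[R]^n M) = _
  have h : ∀ σ : Equiv.Perm (Fin n), PiTensorProduct.reindex R (fun _ => M) σ (t : ⨂[R]^n M) = t :=
    t.2
  simp [sumPerm, h, Fintype.card_perm, Nat.cast_smul_eq_nsmul]

end SymmetricPowers

section ReducedCoproduct

variable (R A : Type u) [CommRing R] [Ring A] [Bialgebra R A]

/-- The projection `a ↦ a - ε(a)` onto the kernel of the counit. -/
def augProj : A →ₗ[R] A := LinearMap.id - Algebra.linearMap R A ∘ₗ Coalgebra.counit

/-- The iterated reduced coproduct `A → A^{⊗n}`. -/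
def redComul : ∀ n : ℕ, A →ₗ[R] ⨂[R]^n A
  | 0 => LinearMap.toSpanSingleton R _ (PiTensorProduct.tprod R Fin.elim0) ∘ₗ Coalgebra.counit
  | n + 1 => (tensorCons R A n).toLinearMap ∘ₗ
      TensorProduct.map (augProj R A) (redComul n) ∘ₗ Coalgebra.comul

variable {R A}

theorem augProj_apply (a : A) :
    augProj R A a = a - algebraMap R A (Coalgebra.counit (R := R) a) := rfl

theorem augProj_one : augProj R A 1 = 0 := by
  simp [augProj_apply]

theorem counit_augProj (a : A) : Coalgebra.counit (R := R) (augProj R A a) = 0 := by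
  simp [augProj_apply]

theorem augProj_augProj : augProj R A ∘ₗ augProj R A = augProj R A := by
  ext a
  rw [LinearMap.comp_apply, augProj_apply (augProj R A a), counit_augProj, map_zero, sub_zero]

theorem comp_augProj {M : Type u} [AddCommGroup M] [Module R M] {f : A →ₗ[R] M} (hf : f 1 = 0) :
    f ∘ₗ augProj R A = f := by
  ext a
  simp [augProj_apply, Algebra.algebraMap_eq_smul_one, hf]

theorem map_augProj_redComul (n : ℕ) :
    PiTensorProduct.map (fun _ => augProj R A) ∘ₗ redComul R A n = redComul R A n := by
  induction n with
  | zero =>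
    ext a
    simp only [redComul, LinearMap.comp_apply, LinearMap.toSpanSingleton_apply, map_smul,
      PiTensorProduct.map_tprod]
    congr 2
    exact Subsingleton.elim _ _
  | succ n ih =>
    rw [redComul, ← LinearMap.comp_assoc, map_comp_tensorCons, LinearMap.comp_assoc,
      ← LinearMap.comp_assoc _ _ (TensorProduct.map _ (PiTensorProduct.map _)),
      ← TensorProduct.map_comp, ih, augProj_augProj]

theorem redComul_one_apply (a : A) :
    redComul R A 1 a = tensorCons R A 0 (augProj R A a ⊗ₜ PiTensorProduct.tprod R Fin.elim0) := by
  have h : TensorProduct.map (augProj R A) (redComul R A 0) =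
      TensorProduct.map (augProj R A)
        (LinearMap.toSpanSingleton R _ (PiTensorProduct.tprod R Fin.elim0)) ∘ₗ
      LinearMap.lTensor A (Coalgebra.counit (R := R)) := by
    rw [LinearMap.lTensor, ← TensorProduct.map_comp]
    rfl
  have h2 : redComul R A 1 a =
    tensorCons R A 0 (TensorProduct.map (augProj R A) (redComul R A 0) (Coalgebra.comul a)) := rfl
  rw [h2, h, LinearMap.comp_apply, Coalgebra.lTensor_counit_comul]
  simp

theorem mem_augIdeal {S : Type u} [CommRing S] [Algebra R S] {f : WithConv (A →ₗ[R] S)} :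
    f ∈ augIdeal R A S ↔ f 1 = 0 := Iff.rfl

theorem exists_eq_comp_redComul_mul {n : ℕ} {S : Type u} [CommRing S] [Algebra R S]
    {f g : WithConv (A →ₗ[R] S)} (hf : f ∈ augIdeal R A S)
    (hg : ∃ φ : (⨂[R]^n A) →ₗ[R] S, g.ofConv = φ ∘ₗ redComul R A n) :
    ∃ φ : (⨂[R]^(n + 1) A) →ₗ[R] S, (f * g).ofConv = φ ∘ₗ redComul R A (n + 1) := by
  obtain ⟨φ, hφ⟩ := hg
  refine ⟨LinearMap.mul' R S ∘ₗ TensorProduct.map f.ofConv φ ∘ₗ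
    (tensorCons R A n).symm.toLinearMap, ?_⟩
  ext a
  rw [LinearMap.convMul_apply, hφ, ← comp_augProj (mem_augIdeal.1 hf), TensorProduct.map_comp,
    comp_augProj (mem_augIdeal.1 hf)]
  simp [redComul]

variable [Coalgebra.IsCocomm R A]

/-- Products of functions in the augmentation ideal are computed by the iterated reduced
coproduct. -/
theorem prod_apply_eq_prodPairing {n : ℕ} {S : Type u} [CommRing S] [Algebra R S]
    (f : Fin n → WithConv (A →ₗ[R] S)) (hf : ∀ i, f i ∈ augIdeal R A S) (a : A) :
    (∏ i, f i) a = prodPairing (fun i => (f i).ofConv) (redComul R A n a) := by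
  induction n generalizing a with
  | zero =>
    simp [redComul, prodPairing_tprod, Algebra.algebraMap_eq_smul_one]
  | succ n ih =>
    have h1 : (∏ i : Fin n, f i.succ).ofConv =
        prodPairing (fun i : Fin n => (f i.succ).ofConv) ∘ₗ redComul R A n :=
      LinearMap.ext fun a => ih (fun i => f i.succ) (fun i => hf i.succ) a
    have h2 := DFunLike.congr_fun (prodPairing_comp_tensorCons (M := A) fun i => (f i).ofConv)
      (TensorProduct.map (augProj R A) (redComul R A n) (Coalgebra.comul a))
    rw [Fin.prod_univ_succ, LinearMap.convMul_apply, h1, ← comp_augProj (mem_augIdeal.1 (hf 0)),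
      TensorProduct.map_comp]
    exact h2.symm

theorem prodPairing_redComul {n : ℕ} {S : Type u} [CommRing S] [Algebra R S]
    (f : Fin n → (A →ₗ[R] S)) (a : A) :
    prodPairing f (redComul R A n a) =
      (∏ i, WithConv.toConv (f i ∘ₗ augProj R A)) a := by
  rw [prod_apply_eq_prodPairing, ← map_augProj_redComul, LinearMap.comp_apply,
    ← LinearMap.comp_apply, prodPairing_comp_map, ← LinearMap.comp_apply (PiTensorProduct.map _),
    map_augProj_redComul]
  intro i
  simp [mem_augIdeal, augProj_one]

theorem redComul_mem_symTensors {n : ℕ} (a : A) (σ : Equiv.Perm (Fin n)) :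
    PiTensorProduct.reindex R (fun _ => A) σ (redComul R A n a) = redComul R A n a := by
  refine ext_prodPairing fun S _ _ f => ?_
  rw [prodPairing_reindex, prodPairing_redComul, prodPairing_redComul]
  rw [Equiv.prod_comp σ fun i => WithConv.toConv (f i ∘ₗ augProj R A)]

theorem exists_eq_comp_redComul {n : ℕ} {S : Type u} [CommRing S] [Algebra R S]
    {f : WithConv (A →ₗ[R] S)} (hf : f ∈ augIdeal R A S ^ (n + 1)) :
    ∃ φ : (⨂[R]^(n + 1) A) →ₗ[R] S, f.ofConv = φ ∘ₗ redComul R A (n + 1) := by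
  induction n generalizing f with
  | zero =>
    rw [zero_add, pow_one] at hf
    rw [← mul_one f]
    refine exists_eq_comp_redComul_mul hf ⟨prodPairing Fin.elim0, LinearMap.ext fun a => ?_⟩
    simp [redComul, prodPairing_tprod, Algebra.algebraMap_eq_smul_one]
  | succ n ih =>
    rw [pow_succ'] at hf
    refine Submodule.mul_induction_on hf (fun g hg h hh => exists_eq_comp_redComul_mul hg (ih hh))
      ?_
    rintro g h ⟨φ, hφ⟩ ⟨ψ, hψ⟩
    exact ⟨φ + ψ, by rw [WithConv.ofConv_add, hφ, hψ, LinearMap.add_comp]⟩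

theorem redComul_eq_zero_of_mem {n : ℕ} {a : A} (ha : a ∈ distFil R A n) :
    redComul R A n a = 0 := by
  refine ext_prodPairing fun S _ _ f => ?_
  rw [prodPairing_redComul, map_zero]
  refine ha S _ ?_
  have h := Ideal.prod_mem_prod (s := Finset.univ) (I := fun _ : Fin n => augIdeal R A S)
    (x := fun i => WithConv.toConv (f i ∘ₗ augProj R A))
    fun i _ => mem_augIdeal.2 (by simp [augProj_one])
  simpa using h

theorem mem_distFil_succ {n : ℕ} {a : A} :
    a ∈ distFil R A (n + 1) ↔ redComul R A (n + 1) a = 0 := by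
  refine ⟨redComul_eq_zero_of_mem, fun ha S _ _ f hf => ?_⟩
  obtain ⟨φ, hφ⟩ := exists_eq_comp_redComul hf
  rw [hφ, LinearMap.comp_apply, ha, map_zero]

theorem distFil_zero : distFil R A 0 = ⊥ := by
  let _ : Module Rᵐᵒᵖ A := Module.compHom A ((RingHom.id R).fromOpposite mul_comm)
  have _ : IsCentralScalar R A := ⟨fun _ _ => rfl⟩
  refine (Submodule.eq_bot_iff _).2 fun a ha => ?_
  have h := ha (TrivSqZeroExt R A) (WithConv.toConv (TrivSqZeroExt.inrHom R A)) (by simp)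
  exact congrArg TrivSqZeroExt.snd h

theorem eq_algebraMap_of_mem_distFil_one {a : A} (ha : a ∈ distFil R A 1) :
    a = algebraMap R A (Coalgebra.counit (R := R) a) := by
  rw [mem_distFil_succ, zero_add, redComul_one_apply, LinearEquiv.map_eq_zero_iff] at ha
  have h := congrArg (TensorProduct.rid R A)
    ((TensorProduct.congr (LinearEquiv.refl R A)
      (PiTensorProduct.isEmptyEquiv (R := R) (s := fun _ : Fin 0 => A) (Fin 0))) |>.congr_arg ha)
  simp [augProj_apply, sub_eq_zero] at h
  exact h

/-- An element of `A_n` whose image under the iterated reduced coproduct vanishes lies in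
`A_{n-1}`. -/
theorem mem_distFil_of_redComul_eq_zero {n : ℕ} {a : A} (ha : a ∈ distFil R A (n + 1))
    (h : redComul R A n a = 0) : a ∈ distFil R A n := by
  cases n with
  | zero =>
    have h2 := congrArg (PiTensorProduct.isEmptyEquiv (R := R) (s := fun _ : Fin 0 => A) (Fin 0)) h
    simp [redComul] at h2
    rw [eq_algebraMap_of_mem_distFil_one ha, h2, map_zero]
    exact zero_mem _
  | succ n => exact mem_distFil_succ.2 h

end ReducedCoproduct

section Purity

variable (R A : Type u) [CommRing R] [Ring A] [Bialgebra R A]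

/-- Restriction of functions along `A → S ⊗ A`. -/
def convRestrict (S T : Type u) [CommRing S] [Algebra R S] [CommRing T] [Algebra R T] [Algebra S T]
    [IsScalarTower R S T] : WithConv (S ⊗[R] A →ₗ[S] T) →+* WithConv (A →ₗ[R] T) where
  toFun f := WithConv.toConv (f.ofConv.restrictScalars R ∘ₗ TensorProduct.mk R S A 1)
  map_one' := by
    ext a
    simp [← Algebra.algebraMap_eq_smul_one, ← IsScalarTower.algebraMap_apply]
  map_zero' := by
    ext a
    simp
  map_add' f g := by
    ext a
    simp
  map_mul' f g := by
    ext a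
    have h := (Coalgebra.Repr.arbitrary R a).eq
    simp only [LinearMap.convMul_apply, LinearMap.comp_apply, LinearMap.restrictScalars_apply,
      TensorProduct.mk_apply, TensorProduct.comul_tmul, ← h]
    simp [TensorProduct.tmul_sum]

/-- Every module embeds in a commutative algebra. -/
theorem exists_algebra_embedding (S M : Type u) [CommRing S] [AddCommGroup M] [Module S M] :
    ∃ (T : Type u) (_ : CommRing T) (_ : Algebra S T) (i : M →ₗ[S] T) (q : T →ₗ[S] M),
      q ∘ₗ i = LinearMap.id := by
  let _ : Module Sᵐᵒᵖ M := Module.compHom M ((RingHom.id S).fromOpposite mul_comm)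
  have _ : IsCentralScalar S M := ⟨fun _ _ => rfl⟩
  exact ⟨TrivSqZeroExt S M, inferInstance, inferInstance, TrivSqZeroExt.inrHom S M,
    TrivSqZeroExt.sndHom S M, LinearMap.ext fun x => TrivSqZeroExt.snd_inr S x⟩

variable [Coalgebra.IsCocomm R A]
variable {R A}

theorem exists_eq_lTensor_sub (hG : IsFlatInfinitesimalFormalMonoid R A) (n : ℕ) {S : Type u}
    [CommRing S] [Algebra R S] (z : S ⊗[R] A)
    (hz : LinearMap.lTensor S (redComul R A (n + 1)) z = 0) :
    z ∈ LinearMap.range (LinearMap.lTensor S (distFil R A (n + 1)).subtype) := by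
  have hz' : z ∈ distFil S (S ⊗[R] A) (n + 1) := by
    intro T _ _ f hf
    let _ : Algebra R T := Algebra.compHom T (algebraMap R S)
    have _ : IsScalarTower R S T := .of_algebraMap_eq' rfl
    have hf' : convRestrict R A S T f ∈ augIdeal R A T ^ (n + 1) := by
      have h : (augIdeal S (S ⊗[R] A) T).map (convRestrict R A S T) ≤ augIdeal R A T :=
        Ideal.map_le_iff_le_comap.2 fun g hg => hg
      refine Ideal.pow_right_mono h _ ?_
      rw [← Ideal.map_pow]
      exact Ideal.mem_map_of_mem _ hf
    obtain ⟨φ, hφ⟩ := exists_eq_comp_redComul hf'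
    let ψ : S ⊗[R] (⨂[R]^(n + 1) A) →ₗ[S] T := TensorProduct.AlgebraTensorModule.lift
      ((LinearMap.lsmul S (⨂[R]^(n + 1) A →ₗ[R] T)).flip φ)
    have hψ : f.ofConv = ψ ∘ₗ (redComul R A (n + 1)).baseChange S := by
      ext a
      have h := DFunLike.congr_fun hφ a
      simpa [ψ, convRestrict] using h
    have h2 : (redComul R A (n + 1)).baseChange S z = 0 := hz
    rw [hψ, LinearMap.comp_apply, h2, map_zero]
  let W : Submodule S (S ⊗[R] A) := LinearMap.range ((distFil R A (n + 1)).subtype.baseChange S)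
  obtain ⟨T, _, _, i, q, hq⟩ := exists_algebra_embedding S ((S ⊗[R] A) ⧸ W)
  let _ : Algebra R T := Algebra.compHom T (algebraMap R S)
  have _ : IsScalarTower R S T := .of_algebraMap_eq' rfl
  have h := (hG.baseChange S (n + 1) T (i ∘ₗ W.mkQ)).1 (fun a ha => by
    have h : W.mkQ (1 ⊗ₜ[R] a) = 0 :=
      (Submodule.Quotient.mk_eq_zero W).2 ⟨1 ⊗ₜ[R] ⟨a, ha⟩, by simp⟩
    change i (W.mkQ (1 ⊗ₜ[R] a)) = 0
    rw [h, map_zero]) z hz'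
  have h2 : W.mkQ z = 0 := by
    have h3 := congrArg q h
    rw [map_zero, LinearMap.comp_apply, ← LinearMap.comp_apply, hq] at h3
    exact h3
  exact (Submodule.Quotient.mk_eq_zero W).1 h2

theorem mem_range_lTensor_distFil (hG : IsFlatInfinitesimalFormalMonoid R A) (n : ℕ) {N : Type u}
    [AddCommGroup N] [Module R N] (z : N ⊗[R] A)
    (hz : LinearMap.lTensor N (redComul R A (n + 1)) z = 0) :
    z ∈ LinearMap.range (LinearMap.lTensor N (distFil R A (n + 1)).subtype) := by
  obtain ⟨S, _, _, i, q, hq⟩ := exists_algebra_embedding R N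
  obtain ⟨w, hw⟩ := exists_eq_lTensor_sub hG n (i.rTensor A z) (by
    rw [← LinearMap.comp_apply, LinearMap.lTensor_comp_rTensor, ← LinearMap.rTensor_comp_lTensor,
      LinearMap.comp_apply, hz, map_zero])
  refine ⟨q.rTensor _ w, ?_⟩
  rw [← LinearMap.comp_apply, LinearMap.lTensor_comp_rTensor, ← LinearMap.rTensor_comp_lTensor,
    LinearMap.comp_apply, hw, ← LinearMap.comp_apply, ← LinearMap.rTensor_comp, hq,
    LinearMap.rTensor_id]
  rfl

/-- If `k p(a)` is divisible, for the iterated reduced coproduct `p`, then `a` is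
divisible modulo the kernel of `p`. -/
theorem exists_of_redComul_eq_smul (hG : IsFlatInfinitesimalFormalMonoid R A) (n : ℕ) {r : R}
    {a : A} {t : ⨂[R]^(n + 1) A} (h : redComul R A (n + 1) a = r • t) :
    ∃ b ∈ distFil R A (n + 1), ∃ a', a = b + r • a' := by
  obtain ⟨w, hw⟩ := mem_range_lTensor_distFil hG n (N := R ⧸ Ideal.span {r})
    (Submodule.Quotient.mk 1 ⊗ₜ a) (by
      rw [LinearMap.lTensor_tmul, h, TensorProduct.tmul_smul, TensorProduct.smul_tmul',
        ← Submodule.Quotient.mk_smul, (Submodule.Quotient.mk_eq_zero _).2 (by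
          simp), TensorProduct.zero_tmul])
  have h0 : (distFil R A (n + 1)).mkQ ∘ₗ (distFil R A (n + 1)).subtype = 0 := by ext; simp
  have h1 : (Submodule.Quotient.mk 1 : R ⧸ Ideal.span {r}) ⊗ₜ[R] (distFil R A (n + 1)).mkQ a =
      0 := by
    rw [← LinearMap.lTensor_tmul, ← hw, ← LinearMap.comp_apply, ← LinearMap.lTensor_comp, h0,
      LinearMap.lTensor_zero, LinearMap.zero_apply]
  have h2 := congrArg (TensorProduct.quotTensorEquivQuotSMul _ (Ideal.span {r})) h1
  rw [map_zero] at h2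
  have h3 : (distFil R A (n + 1)).mkQ a ∈ Ideal.span {r} • (⊤ : Submodule R (A ⧸ _)) := by
    refine (Submodule.Quotient.mk_eq_zero _).1 (Eq.trans ?_ h2)
    exact (one_smul R _).symm.trans
      (TensorProduct.quotTensorEquivQuotSMul_mk_tmul (Ideal.span {r}) 1 _).symm
  rw [Submodule.ideal_span_singleton_smul] at h3
  obtain ⟨c, -, hc⟩ := h3
  obtain ⟨a', rfl⟩ := Submodule.mkQ_surjective _ c
  refine ⟨a - r • a', ?_, a', by simp⟩
  rw [← Submodule.Quotient.mk_eq_zero, Submodule.Quotient.mk_sub]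
  exact sub_eq_zero.2 hc.symm

theorem flat_quotient_distFil (hG : IsFlatInfinitesimalFormalMonoid R A) (n : ℕ) :
    Module.Flat R (A ⧸ distFil R A (n + 1)) := by
  have := hG.flat
  have := flat_tensorPower (R := R) (M := A) (n + 1)
  let j : A ⧸ distFil R A (n + 1) →ₗ[R] ⨂[R]^(n + 1) A :=
    (distFil R A (n + 1)).liftQ (redComul R A (n + 1)) fun a ha => mem_distFil_succ.1 ha
  have hj : ∀ (N : Type u) [AddCommGroup N] [Module R N], Function.Injective (j.lTensor N) := by
    intro N _ _
    refine (injective_iff_map_eq_zero _).2 fun z hz => ?_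
    obtain ⟨z, rfl⟩ := LinearMap.lTensor_surjective N (Submodule.mkQ_surjective _) z
    have hjq : j ∘ₗ (distFil R A (n + 1)).mkQ = redComul R A (n + 1) := Submodule.liftQ_mkQ _ _ _
    rw [← LinearMap.comp_apply, ← LinearMap.lTensor_comp, hjq] at hz
    obtain ⟨w, rfl⟩ := mem_range_lTensor_distFil hG n z hz
    rw [← LinearMap.comp_apply, ← LinearMap.lTensor_comp]
    have : (distFil R A (n + 1)).mkQ ∘ₗ (distFil R A (n + 1)).subtype = 0 := by ext; simp
    rw [this, LinearMap.lTensor_zero, LinearMap.zero_apply]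
  refine Module.Flat.iff_rTensor_preserves_injective_linearMap.2 fun N N' _ _ _ _ f hf => ?_
  refine Function.Injective.of_comp (f := j.lTensor N') ?_
  rw [← LinearMap.coe_comp, LinearMap.lTensor_comp_rTensor, ← LinearMap.rTensor_comp_lTensor,
    LinearMap.coe_comp]
  exact (Module.Flat.rTensor_preserves_injective_linearMap f hf).comp (hj N)

end Purity

section Primitive

variable (R A : Type u) [CommRing R] [Ring A] [Bialgebra R A]

/-- The inclusion of the tangent space in `A`, as a linear map. -/
abbrev tangentIncl : tangent R A →ₗ[R] A := ((tangent R A).incl : tangent R A →ₗ[R] A)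

/-- The map `a ↦ Δ(a) - a ⊗ 1 - 1 ⊗ a`, whose kernel consists of the primitive elements. -/
def primDefect : A →ₗ[R] A ⊗[R] A :=
  Coalgebra.comul - ((TensorProduct.mk R A A).flip 1 + TensorProduct.mk R A A 1)

variable {R A}

theorem tangentIncl_injective : Function.Injective (tangentIncl R A) := Subtype.val_injective

theorem mem_tangent {a : A} :
    a ∈ tangent R A ↔ Coalgebra.comul (R := R) a = a ⊗ₜ[R] 1 + 1 ⊗ₜ[R] a :=
  isDerivation_iff a

theorem counit_eq_zero_of_mem_tangent {a : A} (ha : a ∈ tangent R A) :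
    Coalgebra.counit (R := R) a = 0 := by
  have h := Coalgebra.rTensor_counit_comul (R := R) a
  rw [mem_tangent.1 ha, map_add, LinearMap.rTensor_tmul, LinearMap.rTensor_tmul,
    Bialgebra.counit_one, add_eq_right] at h
  simpa using congrArg (Coalgebra.counit (R := R) ∘ TensorProduct.lid R A) h

theorem augProj_of_mem_tangent {a : A} (ha : a ∈ tangent R A) : augProj R A a = a := by
  rw [augProj_apply, counit_eq_zero_of_mem_tangent ha, map_zero, sub_zero]

theorem primDefect_eq_zero_iff {a : A} : primDefect R A a = 0 ↔ a ∈ tangent R A := by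
  rw [mem_tangent]
  exact sub_eq_zero

theorem exact_tangentIncl_primDefect :
    Function.Exact (tangentIncl R A) (primDefect R A) := fun a => by
  rw [primDefect_eq_zero_iff]
  exact ⟨fun h => ⟨⟨a, h⟩, rfl⟩, by rintro ⟨x, rfl⟩; exact x.2⟩

theorem primDefect_comp_augProj :
    primDefect R A ∘ₗ augProj R A =
      TensorProduct.map (augProj R A) (augProj R A) ∘ₗ Coalgebra.comul := by
  ext a
  have h1 : LinearMap.rTensor A (Algebra.linearMap R A ∘ₗ Coalgebra.counit)
      (Coalgebra.comul (R := R) a) = 1 ⊗ₜ[R] a := by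
    rw [LinearMap.rTensor_comp, LinearMap.comp_apply, Coalgebra.rTensor_counit_comul]
    simp
  have h2 : LinearMap.lTensor A (Algebra.linearMap R A ∘ₗ Coalgebra.counit)
      (Coalgebra.comul (R := R) a) = a ⊗ₜ[R] 1 := by
    rw [LinearMap.lTensor_comp, LinearMap.comp_apply, Coalgebra.lTensor_counit_comul]
    simp
  rw [LinearMap.comp_apply, LinearMap.comp_apply, augProj, ← LinearMap.rTensor_comp_lTensor,
    LinearMap.comp_apply, LinearMap.lTensor_sub, LinearMap.sub_apply,
    LinearMap.sub_apply, h2, LinearMap.rTensor_sub,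
    LinearMap.sub_apply, LinearMap.lTensor_id, LinearMap.id_apply, LinearMap.rTensor_id,
    LinearMap.id_apply, LinearMap.id_apply, map_sub, map_sub (LinearMap.rTensor A _), h1]
  simp [primDefect, Algebra.algebraMap_eq_smul_one,
    TensorProduct.smul_tmul', Algebra.TensorProduct.one_def]
  abel

variable (R A) in
/-- The isomorphism `A ≃ A^{⊗1}`. -/
def tensorOne : A ≃ₗ[R] ⨂[R]^1 A :=
  (TensorProduct.rid R A).symm ≪≫ₗ
    TensorProduct.congr (.refl R A) (PiTensorProduct.isEmptyEquiv (Fin 0)).symm ≪≫ₗ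
    tensorCons R A 0

theorem redComul_one : redComul R A 1 = (tensorOne R A).toLinearMap ∘ₗ augProj R A := by
  ext a
  rw [redComul_one_apply]
  simp only [tensorOne, LinearMap.comp_apply, LinearEquiv.coe_coe, LinearEquiv.trans_apply,
    TensorProduct.rid_symm_apply, TensorProduct.congr_tmul, LinearEquiv.refl_apply]
  congr 2
  rw [LinearEquiv.eq_symm_apply, PiTensorProduct.isEmptyEquiv_apply_tprod]

theorem redComul_two_eq_zero_iff {a : A} :
    redComul R A 2 a = 0 ↔ augProj R A a ∈ tangent R A := by
  have h : redComul R A 2 = ((tensorCons R A 1).toLinearMap ∘ₗ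
      (LinearEquiv.lTensor A (tensorOne R A)).toLinearMap) ∘ₗ
        TensorProduct.map (augProj R A) (augProj R A) ∘ₗ Coalgebra.comul := by
    rw [redComul, redComul_one, ← LinearMap.lTensor_comp_map]
    rfl
  rw [h, ← primDefect_comp_augProj, ← primDefect_eq_zero_iff]
  exact LinearEquiv.map_eq_zero_iff (LinearEquiv.lTensor A (tensorOne R A) ≪≫ₗ tensorCons R A 1)

theorem redComul_mem_range [Module.Flat R A] [Module.Flat R (tangent R A)] {n : ℕ} {a : A}
    (ha : redComul R A (n + 1) a = 0) :
    redComul R A n a ∈ LinearMap.range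
      (PiTensorProduct.map (R := R) fun _ : Fin n => tangentIncl R A) := by
  induction n generalizing a with
  | zero =>
    refine ⟨Coalgebra.counit (R := R) a • PiTensorProduct.tprod R Fin.elim0, ?_⟩
    simp only [redComul, LinearMap.comp_apply, LinearMap.toSpanSingleton_apply, map_smul,
      PiTensorProduct.map_tprod]
    congr 2
    exact Subsingleton.elim _ _
  | succ n ih =>
    let J := PiTensorProduct.map (R := R) fun _ : Fin n => tangentIncl R A
    have hJ : Function.Injective J := map_tensorPower_injective tangentIncl_injective n
    have := flat_tensorPower (R := R) (M := tangent R A) n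
    let K := LinearMap.ker (redComul R A (n + 1))
    let h : K →ₗ[R] ⨂[R]^n (tangent R A) := (LinearEquiv.ofInjective J hJ).symm.toLinearMap ∘ₗ
      (redComul R A n ∘ₗ K.subtype).codRestrict _ fun x => ih x.2
    have hh : J ∘ₗ h = redComul R A n ∘ₗ K.subtype := by
      ext x
      have := LinearEquiv.apply_symm_apply (LinearEquiv.ofInjective J hJ)
        ((redComul R A n ∘ₗ K.subtype).codRestrict (LinearMap.range J) (fun x => ih x.2) x)
      exact congrArg Subtype.val this
    have hred : ∀ m, (redComul R A (m + 1)) a = tensorCons R A m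
        (LinearMap.lTensor A (redComul R A m)
          (LinearMap.rTensor A (augProj R A) (Coalgebra.comul a))) := by
      intro m
      rw [← LinearMap.comp_apply (LinearMap.lTensor A _), LinearMap.lTensor_comp_rTensor]
      rfl
    have h1 := ha
    rw [hred, LinearEquiv.map_eq_zero_iff] at h1
    obtain ⟨w, hw⟩ := (Module.Flat.lTensor_exact A
      (LinearMap.exact_subtype_ker_map (redComul R A (n + 1))) _).1 h1
    have hv : LinearMap.lTensor A J (LinearMap.lTensor A h w) = LinearMap.lTensor A (redComul R A n)
        (LinearMap.rTensor A (augProj R A) (Coalgebra.comul a)) := by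
      rw [← LinearMap.comp_apply, ← LinearMap.lTensor_comp, hh, LinearMap.lTensor_comp,
        LinearMap.comp_apply, hw]
    have h2 : LinearMap.rTensor _ (primDefect R A)
        (LinearMap.lTensor A J (LinearMap.lTensor A h w)) = 0 := by
      rw [hv, ← LinearMap.comp_apply (LinearMap.lTensor A _), LinearMap.lTensor_comp_rTensor,
        ← LinearMap.comp_apply, LinearMap.rTensor_comp_map, primDefect_comp_augProj]
      have h4 : TensorProduct.map (augProj R A) (TensorProduct.map (augProj R A) (redComul R A n))
          (LinearMap.lTensor A Coalgebra.comul (Coalgebra.comul (R := R) a)) = 0 := by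
        refine (LinearEquiv.map_eq_zero_iff (LinearEquiv.lTensor A (tensorCons R A n) ≪≫ₗ
          tensorCons R A (n + 1))).1 (Eq.trans ?_ ha)
        rw [redComul, redComul, ← LinearMap.lTensor_comp_map, ← LinearMap.map_comp_lTensor]
        rfl
      rw [← LinearMap.map_comp_rTensor, LinearMap.comp_apply, ← Coalgebra.coassoc_symm_apply,
        ← LinearEquiv.coe_coe, ← LinearMap.comp_apply, TensorProduct.map_map_comp_assoc_symm_eq,
        LinearMap.comp_apply, h4, map_zero]
    have h3 : LinearMap.rTensor _ (primDefect R A) (LinearMap.lTensor A h w) = 0 := by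
      rw [← LinearMap.comp_apply, LinearMap.rTensor_comp_lTensor, ← LinearMap.lTensor_comp_rTensor,
        LinearMap.comp_apply] at h2
      exact (injective_iff_map_eq_zero _).1
        (Module.Flat.lTensor_preserves_injective_linearMap (M := A ⊗[R] A) J hJ) _ h2
    obtain ⟨v, hv'⟩ := (Module.Flat.rTensor_exact (⨂[R]^n (tangent R A))
      exact_tangentIncl_primDefect _).1 h3
    refine ⟨tensorCons R _ n v, ?_⟩
    rw [hred, ← hv, ← hv', ← LinearMap.comp_apply (LinearMap.lTensor A J),
      LinearMap.lTensor_comp_rTensor]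
    exact DFunLike.congr_fun (map_comp_tensorCons (n := n) (tangentIncl R A)) v

variable [Coalgebra.IsCocomm R A]

theorem mem_distFil_two {a : A} : a ∈ distFil R A 2 ↔ augProj R A a ∈ tangent R A :=
  mem_distFil_succ.trans redComul_two_eq_zero_iff

theorem flat_tangent (hG : IsFlatInfinitesimalFormalMonoid R A) :
    Module.Flat R (tangent R A) := by
  have := hG.flat
  have := flat_quotient_distFil hG 1
  have : Module.Flat R (distFil R A 2) := by
    refine Module.Flat.iff_rTensor_preserves_injective_linearMap.2 fun N N' _ _ _ _ f hf => ?_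
    refine Function.Injective.of_comp (f := (distFil R A 2).subtype.lTensor N') ?_
    rw [← LinearMap.coe_comp, LinearMap.lTensor_comp_rTensor, ← LinearMap.rTensor_comp_lTensor,
      LinearMap.coe_comp]
    exact (Module.Flat.rTensor_preserves_injective_linearMap f hf).comp
      (LinearMap.lTensor_injective_of_exact_of_flat _ (Submodule.mkQ_surjective (distFil R A 2)) _
        (Submodule.subtype_injective _) (LinearMap.exact_subtype_mkQ _) N)
  refine Module.Flat.of_retract (M := distFil R A 2)
    ((tangentIncl R A).codRestrict (distFil R A 2) fun x =>
      mem_distFil_two.2 ((augProj_of_mem_tangent x.2).symm ▸ x.2))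
    ((augProj R A ∘ₗ (distFil R A 2).subtype).codRestrict (tangent R A).toSubmodule
      fun x => mem_distFil_two.1 x.2) ?_
  ext x
  exact augProj_of_mem_tangent x.2

end Primitive

section Translation

variable {R A : Type u} [CommRing R] [Ring A] [Bialgebra R A] [Coalgebra.IsCocomm R A]
  {S : Type u} [CommRing S] [Algebra R S]

variable (S) in
/-- Translation of functions by a primitive element is a derivation. -/
def translate (x : tangent R A) :
    Derivation R (WithConv (A →ₗ[R] S)) (WithConv (A →ₗ[R] S)) :=
  Derivation.mk'
    { toFun f := WithConv.toConv (f.ofConv ∘ₗ LinearMap.mulLeft R (x : A))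
      map_add' f g := rfl
      map_smul' r f := rfl }
    fun f g => by
      ext a
      have h := (Coalgebra.Repr.arbitrary R a).eq
      have hx := mem_tangent.1 x.2
      rw [smul_eq_mul, smul_eq_mul, mul_comm g, add_comm]
      change (f * g) ((x : A) * a) = (_ * g) a + (f * _) a
      simp only [LinearMap.convMul_apply, Bialgebra.comul_mul, hx, ← h, add_mul, Finset.mul_sum,
        map_add, map_sum, Algebra.TensorProduct.tmul_mul_tmul, one_mul, TensorProduct.map_tmul, Finset.sum_add_distrib]
      rfl

theorem translate_apply (x : tangent R A) (f : WithConv (A →ₗ[R] S)) (a : A) :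
    translate S x f a = f (x * a) := rfl

theorem translate_mem_pow (x : tangent R A) {n : ℕ} {f : WithConv (A →ₗ[R] S)}
    (hf : f ∈ augIdeal R A S ^ (n + 1)) : translate S x f ∈ augIdeal R A S ^ n := by
  induction n generalizing f with
  | zero => simp
  | succ n ih =>
    rw [pow_succ'] at hf
    refine Submodule.mul_induction_on hf (fun g hg h hh => ?_) fun g h hg hh => ?_
    · rw [Derivation.leibniz, smul_eq_mul, smul_eq_mul]
      refine add_mem ?_ (Ideal.mul_mem_right _ _ hh)
      rw [pow_succ']
      exact Ideal.mul_mem_mul hg (ih hh)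
    · rw [map_add]
      exact add_mem hg hh

theorem one_mem_distFil : (1 : A) ∈ distFil R A 1 := fun S _ _ f hf => by
  rw [pow_one] at hf
  exact hf

theorem mul_mem_distFil (x : tangent R A) {n : ℕ} {a : A} (ha : a ∈ distFil R A n) :
    (x : A) * a ∈ distFil R A (n + 1) := fun S _ _ _ hf =>
  ha S _ (translate_mem_pow x hf)

theorem list_prod_mem_distFil (l : List (tangent R A)) :
    (l.map fun x : tangent R A => (x : A)).prod ∈ distFil R A (l.length + 1) := by
  induction l with
  | nil => exact one_mem_distFil
  | cons x l ih => exact mul_mem_distFil x ih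

theorem ofFn_prod_mem_distFil {n : ℕ} (x : Fin n → tangent R A) :
    (List.ofFn fun i => (x i : A)).prod ∈ distFil R A (n + 1) := by
  have h := list_prod_mem_distFil (List.ofFn x)
  rw [List.map_ofFn, List.length_ofFn] at h
  exact h

theorem prod_erase_swap {M : Type*} [CommMonoid M] {n : ℕ} (f : Fin (n + 1) → M)
    (p : Fin (n + 1)) :
    ∏ j ∈ Finset.univ.erase p, f j = ∏ j : Fin n, f (Equiv.swap 0 p j.succ) := by
  have h : (Finset.univ.erase 0 : Finset (Fin (n + 1))) = Finset.univ.map (Fin.succEmb n) := by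
    ext i
    refine Fin.cases ?_ (fun j => ?_) i <;> simp [Fin.succ_ne_zero]
  have h2 : ∏ j ∈ Finset.univ.erase 0, f (Equiv.swap 0 p j) =
      ∏ j : Fin n, f (Equiv.swap 0 p j.succ) := by
    rw [h, Finset.prod_map]
    rfl
  rw [← h2]
  refine (Finset.prod_equiv (Equiv.swap 0 p) (fun i => ?_) fun _ _ => rfl).symm
  simp [Equiv.swap_apply_eq_iff]

theorem derivation_prod {ι B : Type*} [DecidableEq ι] [CommRing B] [Algebra R B]
    (D : Derivation R B B) (s : Finset ι) (f : ι → B) :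
    D (∏ i ∈ s, f i) = ∑ p ∈ s, (∏ j ∈ s.erase p, f j) * D (f p) := by
  induction s using Finset.induction_on with
  | empty => simp
  | insert k s hk ih =>
    rw [Finset.prod_insert hk, D.leibniz, ih, Finset.sum_insert hk, Finset.erase_insert hk,
      smul_eq_mul, smul_eq_mul, add_comm, Finset.mul_sum]
    congr 1
    refine Finset.sum_congr rfl fun p hp => ?_
    have hpk : p ≠ k := fun h => hk (h ▸ hp)
    rw [Finset.erase_insert_of_ne hpk.symm, Finset.prod_insert fun h => hk (Finset.mem_of_mem_erase h),
      mul_assoc]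

theorem prod_apply_mul (x : tangent R A) {n : ℕ} (f : Fin (n + 1) → WithConv (A →ₗ[R] S))
    (hf : ∀ i, f i ∈ augIdeal R A S) {a : A} (ha : a ∈ distFil R A (n + 1)) :
    (∏ i, f i) (x * a) = ∑ p, f p x * (∏ j : Fin n, f (Equiv.swap 0 p j.succ)) a := by
  classical
  have hD : translate S x (∏ i, f i) =
      ∑ p, (∏ j : Fin n, f (Equiv.swap 0 p j.succ)) * translate S x (f p) := by
    simp only [← prod_erase_swap]
    exact derivation_prod _ _ _
  have hp : ∀ p, ((∏ j : Fin n, f (Equiv.swap 0 p j.succ)) * translate S x (f p)) a =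
      f p x * (∏ j : Fin n, f (Equiv.swap 0 p j.succ)) a := by
    intro p
    have h1 : (∏ j : Fin n, f (Equiv.swap 0 p j.succ)) *
        (translate S x (f p) - (f p x) • 1) ∈ augIdeal R A S ^ (n + 1) := by
      rw [pow_succ]
      refine Ideal.mul_mem_mul ?_ ?_
      · simpa using Ideal.prod_mem_prod (s := Finset.univ)
          (I := fun _ : Fin n => augIdeal R A S) fun i _ => hf (Equiv.swap 0 p i.succ)
      · rw [mem_augIdeal]
        simp [translate_apply]
    have h2 := ha S _ h1
    rw [mul_sub, mul_smul_comm, mul_one] at h2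
    exact sub_eq_zero.1 h2
  rw [← translate_apply, hD]
  refine Eq.trans ?_ (Finset.sum_congr rfl fun p _ => hp p)
  simp

/-- The pairing of a product of `n` functions of the augmentation ideal with a product of `n`
primitive elements. -/
theorem prod_apply_prod {n : ℕ} (f : Fin n → WithConv (A →ₗ[R] S))
    (hf : ∀ i, f i ∈ augIdeal R A S) (x : Fin n → tangent R A) :
    (∏ i, f i) (List.ofFn fun i => (x i : A)).prod =
      ∑ σ : Equiv.Perm (Fin n), ∏ i, f (σ i) (x i) := by
  induction n with
  | zero => simp
  | succ n ih =>
    rw [List.ofFn_succ, List.prod_cons, prod_apply_mul (x 0) f hf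
      (ofFn_prod_mem_distFil fun i => x i.succ),
      ← Equiv.Perm.decomposeFin.symm.sum_comp, Fintype.sum_prod_type]
    refine Finset.sum_congr rfl fun p _ => ?_
    rw [ih (fun j => f (Equiv.swap 0 p j.succ)) (fun j => hf _) fun i => x i.succ, Finset.mul_sum]
    refine Finset.sum_congr rfl fun σ _ => ?_
    rw [Fin.prod_univ_succ]
    simp

theorem redComul_prod {n : ℕ} (x : Fin n → tangent R A) :
    redComul R A n (List.ofFn fun i => (x i : A)).prod =
      PiTensorProduct.map (fun _ => tangentIncl R A)
        (sumPerm (R := R) n (PiTensorProduct.tprod R x)) := by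
  refine ext_prodPairing fun S _ _ f => ?_
  rw [prodPairing_redComul, prod_apply_prod _ fun i => mem_augIdeal.2 (by simp [augProj_one]),
    sumPerm_tprod, map_sum, map_sum, ← Equiv.sum_comp (Equiv.inv (Equiv.Perm (Fin n)))]
  refine Finset.sum_congr rfl fun σ _ => ?_
  rw [PiTensorProduct.map_tprod, prodPairing_tprod, ← Equiv.prod_comp σ]
  refine Finset.prod_congr rfl fun i _ => ?_
  have h := augProj_of_mem_tangent (x (σ i)).2
  simp [h]

theorem exists_mem_distFil (hG : IsFlatInfinitesimalFormalMonoid R A) (a : A) :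
    ∃ n, a ∈ distFil R A n := by
  let W := ⨆ n, distFil R A n
  obtain ⟨T, _, _, i, q, hq⟩ := exists_algebra_embedding R (A ⧸ W)
  obtain ⟨f, -, hf⟩ := hG.complete T (fun _ => 0) fun _ => by simp
  have h1 : i ∘ₗ W.mkQ = 0 := by
    refine (hf (i ∘ₗ W.mkQ) fun n => ?_).trans (hf 0 fun n => by simp).symm
    ext x
    have : W.mkQ x = 0 := (Submodule.Quotient.mk_eq_zero W).2 (Submodule.mem_iSup_of_mem n x.2)
    simp only [LinearMap.comp_apply, Submodule.subtype_apply, this, map_zero, LinearMap.zero_apply]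
  have h2 : W.mkQ a = 0 := by
    rw [← LinearMap.id_apply (R := R) (W.mkQ a), ← hq, LinearMap.comp_apply,
      ← LinearMap.comp_apply i, h1, LinearMap.zero_apply, map_zero]
  have h3 : a ∈ ⨆ n, distFil R A n := (Submodule.Quotient.mk_eq_zero W).1 h2
  exact (Submodule.mem_iSup_of_directed _
    (monotone_nat_of_le_succ fun n => distFil_mono R A n.le_succ).directed_le).1 h3

end Translation

section EnvelopingFiltration

variable {R L : Type u} [CommRing R] [LieRing L] [LieAlgebra R L]

local notation "U" => UniversalEnvelopingAlgebra R L
local notation "ιU" => UniversalEnvelopingAlgebra.ι R (L := L)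

theorem envFil_zero : envFil R L 0 = ⊥ := by
  simp [envFil]

theorem pow_le_envFil {i n : ℕ} (h : i < n) :
    LinearMap.range (ιU : L →ₗ⁅R⁆ U).toLinearMap ^ i ≤ envFil R L n :=
  le_iSup₂_of_le i h le_rfl

theorem envFil_mono {m n : ℕ} (h : m ≤ n) : envFil R L m ≤ envFil R L n :=
  iSup₂_le fun _ hi => pow_le_envFil (hi.trans_le h)

theorem envFil_succ (n : ℕ) : envFil R L (n + 1) =
    envFil R L n ⊔ LinearMap.range (ιU : L →ₗ⁅R⁆ U).toLinearMap ^ n := by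
  refine le_antisymm (iSup₂_le fun i hi => ?_)
    (sup_le (envFil_mono n.le_succ) (pow_le_envFil n.lt_succ_self))
  obtain h | rfl := Nat.lt_succ_iff_lt_or_eq.1 hi
  · exact (pow_le_envFil h).trans le_sup_left
  · exact le_sup_right

theorem ι_mul_mem_envFil (x : L) {n : ℕ} {u : U} (hu : u ∈ envFil R L n) :
    ιU x * u ∈ envFil R L (n + 1) := by
  suffices h : envFil R L n ≤ (envFil R L (n + 1)).comap (LinearMap.mulLeft R (ιU x)) from h hu
  refine iSup₂_le fun i hi v hv => ?_
  refine pow_le_envFil (Nat.succ_lt_succ hi) ?_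
  rw [pow_succ']
  exact Submodule.mul_mem_mul ⟨x, rfl⟩ hv

theorem list_prod_mem_envFil (l : List L) :
    (l.map fun x : L => (ιU x : U)).prod ∈ envFil R L (l.length + 1) := by
  induction l with
  | nil => exact pow_le_envFil Nat.one_pos (by
      rw [pow_zero]
      exact Submodule.one_le.1 le_rfl)
  | cons x l ih => exact ι_mul_mem_envFil x ih

/-- Up to terms of lower order, products in the enveloping algebra do not depend on the order
of the factors. -/
theorem list_prod_sub_mem_envFil {l l' : List L} (h : l.Perm l') :
    (l.map fun x : L => (ιU x : U)).prod - (l'.map fun x : L => (ιU x : U)).prod ∈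
      envFil R L l.length := by
  induction h with
  | nil => simp
  | cons x _ ih =>
    rw [List.map_cons, List.map_cons, List.prod_cons, List.prod_cons, ← mul_sub]
    exact ι_mul_mem_envFil x ih
  | swap x y l =>
    have h : ((y :: x :: l).map fun x : L => (ιU x : U)).prod -
        ((x :: y :: l).map fun x : L => (ιU x : U)).prod =
          ιU ⁅y, x⁆ * (l.map fun x : L => (ιU x : U)).prod := by
      simp only [List.map_cons, List.prod_cons]
      rw [LieHom.map_lie, LieRing.of_associative_ring_bracket, sub_mul, mul_assoc, mul_assoc]
    rw [h]
    exact ι_mul_mem_envFil _ (list_prod_mem_envFil l)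
  | trans h₁ _ ih₁ ih₂ =>
    rw [← h₁.length_eq] at ih₂
    simpa using add_mem ih₁ ih₂

theorem envFil_mul_le (m n : ℕ) : envFil R L m * envFil R L n ≤ envFil R L (m + n) := by
  rw [envFil, Submodule.iSup_mul]
  refine iSup_le fun i => ?_
  rw [Submodule.iSup_mul]
  refine iSup_le fun hi => ?_
  rw [envFil, Submodule.mul_iSup]
  refine iSup_le fun j => ?_
  rw [Submodule.mul_iSup]
  refine iSup_le fun hj => ?_
  rw [← pow_add]
  exact pow_le_envFil (by omega)

theorem exists_mem_envFil (u : U) : ∃ n, u ∈ envFil R L n := by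
  obtain ⟨t, rfl⟩ : ∃ t, UniversalEnvelopingAlgebra.mkAlgHom R L t = u :=
    Quotient.exists_rep u
  induction t using TensorAlgebra.induction with
  | algebraMap r =>
    refine ⟨1, pow_le_envFil Nat.one_pos ?_⟩
    rw [AlgHom.commutes, pow_zero]
    exact Submodule.algebraMap_mem r
  | ι x =>
    refine ⟨2, pow_le_envFil Nat.one_lt_two ?_⟩
    rw [pow_one]
    exact ⟨x, rfl⟩
  | mul s t hs ht =>
    obtain ⟨m, hm⟩ := hs
    obtain ⟨n, hn⟩ := ht
    exact ⟨m + n, map_mul (UniversalEnvelopingAlgebra.mkAlgHom R L) s t ▸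
      envFil_mul_le m n (Submodule.mul_mem_mul hm hn)⟩
  | add s t hs ht =>
    obtain ⟨m, hm⟩ := hs
    obtain ⟨n, hn⟩ := ht
    exact ⟨m + n, map_add (UniversalEnvelopingAlgebra.mkAlgHom R L) s t ▸
      add_mem (envFil_mono (Nat.le_add_right m n) hm) (envFil_mono (Nat.le_add_left n m) hn)⟩

variable (R L) in
/-- The product `x_1 ⊗ ⋯ ⊗ x_n ↦ x_1 ⋯ x_n`, with values in `U(L)_n`. -/
def envProd (n : ℕ) : MultilinearMap R (fun _ : Fin n => L) (envFil R L (n + 1)) :=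
  ((MultilinearMap.mkPiAlgebraFin R n U).compLinearMap
    fun _ => (ιU : L →ₗ⁅R⁆ U).toLinearMap).codRestrict _ fun x => prod_mem_envFil R x

theorem envProd_apply {n : ℕ} (x : Fin n → L) :
    envProd R L n x = ⟨_, prod_mem_envFil R x⟩ := rfl

variable (R L) in
/-- The morphism `S^n L → U(L)_n / U(L)_{n-1}` induced by multiplication. -/
def symToGr (n : ℕ) : SymPow R L n →ₗ[R] Gr (envFil R L) n :=
  symPowLift (((envFil R L n).submoduleOf (envFil R L (n + 1))).mkQ.compMultilinearMap
    (envProd R L n)) fun x σ => (Submodule.Quotient.eq _).2 <| by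
      have h := list_prod_sub_mem_envFil (R := R) (σ.ofFn_comp_perm x).symm
      rw [List.map_ofFn, List.map_ofFn, List.length_ofFn] at h
      exact h

theorem symToGr_symProd {n : ℕ} (x : Fin n → L) :
    symToGr R L n (symProd x) = Submodule.Quotient.mk ⟨_, prod_mem_envFil R x⟩ :=
  symPowLift_symProd _ _ _

theorem exists_envProd_eq {n : ℕ} {u : U}
    (hu : u ∈ LinearMap.range (ιU : L →ₗ⁅R⁆ U).toLinearMap ^ n) :
    ∃ t, (PiTensorProduct.lift (envProd R L n) t : U) = u := by
  induction n generalizing u with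
  | zero =>
    rw [pow_zero] at hu
    obtain ⟨r, rfl⟩ := Submodule.mem_one.1 hu
    refine ⟨r • PiTensorProduct.tprod R Fin.elim0, ?_⟩
    simp [envProd_apply, Algebra.algebraMap_eq_smul_one]
  | succ n ih =>
    rw [pow_succ'] at hu
    refine Submodule.mul_induction_on hu ?_ ?_
    · rintro _ ⟨x, rfl⟩ v hv
      obtain ⟨t, rfl⟩ := ih hv
      have h : (envFil R L (n + 2)).subtype ∘ₗ PiTensorProduct.lift (envProd R L (n + 1)) ∘ₗ
          (tensorCons R L n).toLinearMap ∘ₗ TensorProduct.mk R L _ x =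
            LinearMap.mulLeft R (ιU x) ∘ₗ (envFil R L (n + 1)).subtype ∘ₗ
              PiTensorProduct.lift (envProd R L n) :=
        PiTensorProduct.ext (MultilinearMap.ext fun y => by
          simp [envProd_apply, List.ofFn_succ])
      exact ⟨tensorCons R L n (x ⊗ₜ t), DFunLike.congr_fun h t⟩
    · rintro _ _ ⟨s, rfl⟩ ⟨t, rfl⟩
      exact ⟨s + t, by simp⟩

theorem symToGr_surjective (n : ℕ) : Function.Surjective (symToGr R L n) := by
  intro y
  obtain ⟨⟨u, hu⟩, rfl⟩ := Submodule.mkQ_surjective _ y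
  obtain ⟨v, hv, w, hw, rfl⟩ := Submodule.mem_sup.1 (envFil_succ (R := R) (L := L) n ▸ hu)
  obtain ⟨t, rfl⟩ := exists_envProd_eq hw
  refine ⟨(symRel R L n).mkQ t, ?_⟩
  have h : symToGr R L n ∘ₗ (symRel R L n).mkQ = Submodule.mkQ _ ∘ₗ
      PiTensorProduct.lift (envProd R L n) :=
    PiTensorProduct.ext (MultilinearMap.ext fun x => by
      refine (symToGr_symProd x).trans ?_
      exact congrArg Submodule.Quotient.mk (PiTensorProduct.lift.tprod (φ := envProd R L n) x).symm)
  refine (DFunLike.congr_fun h t).trans ((Submodule.Quotient.eq _).2 ?_)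
  simpa [Submodule.submoduleOf] using hv

end EnvelopingFiltration

section TensorRat

variable {R M N : Type u} [CommRing R] [AddCommGroup M] [Module R M] [AddCommGroup N] [Module R N]

theorem tensorRat_bijective {φ : M →ₗ[R] N} (hφ : Function.Injective φ)
    (h : ∀ y, ∃ m : ℕ, m ≠ 0 ∧ (m : R) • y ∈ LinearMap.range φ) :
    Function.Bijective (tensorRat φ) := by
  constructor
  · exact Module.Flat.rTensor_preserves_injective_linearMap (M := ℚ)
      φ.toAddMonoidHom.toIntLinearMap hφ
  · intro z
    induction z with
    | zero => exact ⟨0, map_zero _⟩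
    | add y z hy hz =>
      obtain ⟨y, rfl⟩ := hy
      obtain ⟨z, rfl⟩ := hz
      exact ⟨y + z, map_add _ _ _⟩
    | tmul y q =>
      obtain ⟨m, hm, x, hx⟩ := h y
      refine ⟨x ⊗ₜ (q / m), ?_⟩
      have h1 : tensorRat φ (x ⊗ₜ (q / m)) = φ x ⊗ₜ[ℤ] (q / m) := rfl
      have h2 : q = (m : ℤ) • (q / m) := by
        have : (m : ℚ) ≠ 0 := by exact_mod_cast hm
        simp; field_simp
      rw [h1, hx, Nat.cast_smul_eq_nsmul, ← natCast_zsmul, TensorProduct.smul_tmul, ← h2]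

theorem tensorRat_symMap_bijective [Module.Flat ℤ R] [Module.Flat R M] (n : ℕ) :
    Function.Bijective (tensorRat (symMap (R := R) (M := M) n)) := by
  have := isAddTorsionFree_of_flat R (M := R)
  exact tensorRat_bijective (symMap_injective n) fun t =>
    ⟨n.factorial, n.factorial_ne_zero, _, symMap_mkQ t⟩

end TensorRat

section EnvelopingMap

variable (R A : Type u) [CommRing R] [Ring A] [Bialgebra R A]

/-- The morphism of bialgebras `U(T_e 𝔾) → A` which extends the inclusion `T_e 𝔾 ⊆ A`. -/
def envMap : UniversalEnvelopingAlgebra R (tangent R A) →ₐc[R] A :=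
  BialgHom.ofAlgHom (UniversalEnvelopingAlgebra.lift R (tangent R A).incl)
    (UniversalEnvelopingAlgebra.hom_ext _ (LieHom.ext fun x => by
      have h : envCounit R (tangent R A) (UniversalEnvelopingAlgebra.ι R x) = 0 := envCounit_ι R _ x
      have h2 := counit_eq_zero_of_mem_tangent x.2
      exact ((congrArg (Coalgebra.counit (R := R))
        (UniversalEnvelopingAlgebra.lift_ι_apply R (tangent R A).incl x)).trans h2).trans h.symm))
    (UniversalEnvelopingAlgebra.hom_ext _ (LieHom.ext fun x => by
      have h := envComul_ι R (tangent R A) x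
      have h2 := mem_tangent.1 x.2
      have h3 := UniversalEnvelopingAlgebra.lift_ι_apply R (tangent R A).incl x
      refine (congrArg (Algebra.TensorProduct.map _ _) h).trans (Eq.trans ?_
        (h2.symm.trans (congrArg (Coalgebra.comul (R := R)) h3.symm)))
      rw [map_add, Algebra.TensorProduct.map_tmul, Algebra.TensorProduct.map_tmul, h3, map_one]
      rfl))

theorem coe_envMap : (envMap R A : UniversalEnvelopingAlgebra R (tangent R A) →ₐ[R] A) =
    UniversalEnvelopingAlgebra.lift R (tangent R A).incl := rfl

variable {R A}

theorem envMap_ι (x : tangent R A) :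
    envMap R A (UniversalEnvelopingAlgebra.ι R x) = x :=
  UniversalEnvelopingAlgebra.lift_ι_apply R (tangent R A).incl x

theorem envMap_prod {n : ℕ} (x : Fin n → tangent R A) :
    envMap R A (List.ofFn fun i => UniversalEnvelopingAlgebra.ι R (x i)).prod =
      (List.ofFn fun i => (x i : A)).prod := by
  rw [map_list_prod, List.map_ofFn]
  congr 2
  funext i
  exact envMap_ι (x i)

variable [Coalgebra.IsCocomm R A]

theorem envFil_le_comap (n : ℕ) : envFil R (tangent R A) n ≤ (distFil R A n).comap
    (envMap R A : UniversalEnvelopingAlgebra R (tangent R A) →ₐ[R] A).toLinearMap := by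
  have h : ∀ i, LinearMap.range (UniversalEnvelopingAlgebra.ι R (L := tangent R A)).toLinearMap ^ i ≤
      (distFil R A (i + 1)).comap
        (envMap R A : UniversalEnvelopingAlgebra R (tangent R A) →ₐ[R] A).toLinearMap := by
    intro i
    induction i with
    | zero =>
      rw [pow_zero, Submodule.one_le]
      change envMap R A 1 ∈ distFil R A 1
      rw [map_one]
      exact one_mem_distFil
    | succ i ih =>
      rw [pow_succ']
      refine Submodule.mul_le.2 ?_
      rintro _ ⟨x, rfl⟩ v hv
      change envMap R A (UniversalEnvelopingAlgebra.ι R x * v) ∈ distFil R A (i + 1 + 1)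
      rw [map_mul, envMap_ι]
      exact mul_mem_distFil x (ih hv)
  exact iSup₂_le fun i hi => (h i).trans (Submodule.comap_mono (distFil_mono R A hi))

end EnvelopingMap

section Gamma

variable {R A : Type u} [CommRing R] [Ring A] [Bialgebra R A]
  [Module.Flat R A] [Module.Flat R (tangent R A)]

variable (R A) in
/-- The inclusion `(T_e 𝔾)^{⊗n} → A^{⊗n}`. -/
def tangentTensor (n : ℕ) : (⨂[R]^n (tangent R A)) →ₗ[R] ⨂[R]^n A :=
  PiTensorProduct.map fun _ => tangentIncl R A

theorem tangentTensor_injective (n : ℕ) : Function.Injective (tangentTensor R A n) :=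
  map_tensorPower_injective tangentIncl_injective n

variable [Coalgebra.IsCocomm R A]

variable (R A) in
/-- The iterated reduced coproduct on `A_n`, as a tensor of the tangent space. -/
def tangentComul (n : ℕ) : distFil R A (n + 1) →ₗ[R] ⨂[R]^n (tangent R A) :=
  (LinearEquiv.ofInjective _ (tangentTensor_injective n)).symm.toLinearMap ∘ₗ
    (redComul R A n ∘ₗ (distFil R A (n + 1)).subtype).codRestrict _ fun a =>
      redComul_mem_range (redComul_eq_zero_of_mem a.2)

theorem tangentTensor_tangentComul {n : ℕ} (a : distFil R A (n + 1)) :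
    tangentTensor R A n (tangentComul R A n a) = redComul R A n a :=
  congrArg Subtype.val (LinearEquiv.apply_symm_apply
    (LinearEquiv.ofInjective _ (tangentTensor_injective n))
      ((redComul R A n ∘ₗ (distFil R A (n + 1)).subtype).codRestrict _ (fun a =>
        redComul_mem_range (redComul_eq_zero_of_mem a.2)) a))

variable (R A) in
/-- The iterated reduced coproduct on `A_n`, as a symmetric tensor of the tangent space. -/
def symComul (n : ℕ) : distFil R A (n + 1) →ₗ[R] symTensors R (tangent R A) n :=
  (tangentComul R A n).codRestrict _ fun a σ => tangentTensor_injective n <|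
    (PiTensorProduct.map_reindex (R := R) (fun _ : Fin n => tangentIncl R A) σ _).trans <| by
      change PiTensorProduct.reindex R (fun _ => A) σ
        (tangentTensor R A n (tangentComul R A n a)) = _
      rw [tangentTensor_tangentComul, redComul_mem_symTensors]

theorem tangentTensor_symComul {n : ℕ} (a : distFil R A (n + 1)) :
    tangentTensor R A n (symComul R A n a : ⨂[R]^n (tangent R A)) = redComul R A n a :=
  tangentTensor_tangentComul a

theorem symComul_eq_zero_iff {n : ℕ} (a : distFil R A (n + 1)) :
    symComul R A n a = 0 ↔ (a : A) ∈ distFil R A n := by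
  have h : symComul R A n a = 0 ↔ redComul R A n a = 0 := by
    rw [← tangentTensor_symComul, map_eq_zero_iff _ (tangentTensor_injective n),
      Submodule.coe_eq_zero]
  rw [h]
  exact ⟨mem_distFil_of_redComul_eq_zero a.2, redComul_eq_zero_of_mem⟩

variable (R A) in
/-- The morphism `A_n / A_{n-1} → S_n(T_e 𝔾)` dual to multiplication. -/
def grToSym (n : ℕ) : Gr (distFil R A) n →ₗ[R] symTensors R (tangent R A) n :=
  Submodule.liftQ _ (symComul R A n) fun a ha => (symComul_eq_zero_iff a).2 ha

theorem grToSym_mk {n : ℕ} (a : distFil R A (n + 1)) :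
    grToSym R A n (Submodule.Quotient.mk a) = symComul R A n a := rfl

theorem grToSym_injective (n : ℕ) : Function.Injective (grToSym R A n) := by
  refine (injective_iff_map_eq_zero _).2 fun y hy => ?_
  obtain ⟨a, rfl⟩ := Submodule.mkQ_surjective _ y
  exact (Submodule.Quotient.mk_eq_zero _).2 ((symComul_eq_zero_iff a).1 hy)

/-- The morphism `grToSym` is dual to the multiplication of functions. -/
theorem prod_apply_eq_prodPairing_symComul {n : ℕ} (a : distFil R A (n + 1)) {S : Type u}
    [CommRing S] [Algebra R S] (f : Fin n → WithConv (A →ₗ[R] S))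
    (hf : ∀ i, f i ∈ augIdeal R A S) :
    (∏ i, f i) (a : A) = prodPairing (fun i => (f i).ofConv ∘ₗ tangentIncl R A)
      (symComul R A n a : ⨂[R]^n (tangent R A)) := by
  rw [prod_apply_eq_prodPairing f hf, ← tangentTensor_symComul, ← prodPairing_comp_map]
  rfl

theorem grToSym_grMap_symToGr (n : ℕ) :
    grToSym R A n ∘ₗ grMap _ envFil_le_comap n ∘ₗ symToGr R (tangent R A) n = symMap n := by
  refine symPow_hom_ext fun x => ?_
  rw [LinearMap.comp_apply, LinearMap.comp_apply, symToGr_symProd]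
  refine Subtype.ext (tangentTensor_injective n ?_)
  refine (tangentTensor_symComul ⟨envMap R A _, _⟩).trans ?_
  exact (congrArg _ (envMap_prod x)).trans (redComul_prod x)

theorem exists_redComul_envMap {n : ℕ} (t : symTensors R (tangent R A) n) :
    ∃ u ∈ envFil R (tangent R A) (n + 1), redComul R A n (envMap R A u) =
      (n.factorial : R) • tangentTensor R A n t := by
  have h := DFunLike.congr_fun (grToSym_grMap_symToGr (R := R) (A := A) n)
    ((symRel R (tangent R A) n).mkQ t)
  rw [symMap_mkQ] at h
  obtain ⟨⟨u, hu⟩, hu'⟩ := Submodule.mkQ_surjective _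
    (symToGr R (tangent R A) n ((symRel R (tangent R A) n).mkQ t))
  rw [LinearMap.comp_apply, LinearMap.comp_apply, ← hu'] at h
  refine ⟨u, hu, ?_⟩
  have h2 := congrArg (fun s => tangentTensor R A n (s : symTensors R (tangent R A) n)) h
  refine (tangentTensor_symComul ⟨envMap R A u, envFil_le_comap _ hu⟩).symm.trans (h2.trans ?_)
  simp

theorem grToSym_surjective [Module.Flat ℤ R] (hG : IsFlatInfinitesimalFormalMonoid R A) (n : ℕ) :
    Function.Surjective (grToSym R A n) := by
  intro t
  suffices h : ∃ a ∈ distFil R A (n + 1), redComul R A n a = tangentTensor R A n t by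
    obtain ⟨a, ha, h⟩ := h
    refine ⟨Submodule.Quotient.mk ⟨a, ha⟩, Subtype.ext (tangentTensor_injective n ?_)⟩
    rw [grToSym_mk, tangentTensor_symComul, h]
  obtain ⟨u, hu, h⟩ := exists_redComul_envMap t
  have ha := envFil_le_comap _ hu
  cases n with
  | zero => exact ⟨_, ha, h.trans (by simp)⟩
  | succ n =>
    obtain ⟨b, hb, a, hab⟩ := exists_of_redComul_eq_smul hG n h
    have hfl := fun m => flat_tensorPower (R := R) (M := A) m
    have htf : ∀ m, IsAddTorsionFree (⨂[R]^m A) := fun m => isAddTorsionFree_of_flat R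
    have hb1 := redComul_eq_zero_of_mem hb
    have hb2 := redComul_eq_zero_of_mem (distFil_mono R A (n + 1).le_succ hb)
    refine ⟨a, mem_distFil_succ.2 ?_, ?_⟩
    · refine eq_zero_of_natCast_smul_eq_zero (R := R) (n + 1).factorial_ne_zero ?_
      have h1 := redComul_eq_zero_of_mem ha
      change redComul R A _ (envMap R A u) = 0 at h1
      rwa [hab, map_add, hb2, zero_add, map_smul] at h1
    · rw [hab, map_add, hb1, zero_add, map_smul] at h
      refine sub_eq_zero.1 (eq_zero_of_natCast_smul_eq_zero (R := R) (n + 1).factorial_ne_zero ?_)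
      rw [smul_sub, h, sub_self]

theorem grMap_injective_aux {n : ℕ} [Module.Flat ℤ R] :
    Function.Injective (grMap _ (envFil_le_comap (R := R) (A := A)) n ∘ₗ
      symToGr R (tangent R A) n) := by
  have := isAddTorsionFree_of_flat R (M := R)
  have h := symMap_injective (R := R) (M := tangent R A) n
  rw [← grToSym_grMap_symToGr] at h
  exact Function.Injective.of_comp h

theorem symToGr_bijective [Module.Flat ℤ R] (n : ℕ) :
    Function.Bijective (symToGr R (tangent R A) n) :=
  ⟨Function.Injective.of_comp (grMap_injective_aux (R := R) (A := A)), symToGr_surjective n⟩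

theorem grMap_injective [Module.Flat ℤ R] (n : ℕ) :
    Function.Injective (grMap _ (envFil_le_comap (R := R) (A := A)) n) :=
  Function.Injective.of_comp_right grMap_injective_aux (symToGr_surjective n)

theorem tensorRat_grMap_bijective [Module.Flat ℤ R] (n : ℕ) :
    Function.Bijective (tensorRat (grMap _ (envFil_le_comap (R := R) (A := A)) n)) := by
  refine tensorRat_bijective (grMap_injective n) fun y => ?_
  refine ⟨n.factorial, n.factorial_ne_zero,
    symToGr R (tangent R A) n ((symRel R (tangent R A) n).mkQ (grToSym R A n y)), grToSym_injective n ?_⟩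
  have h := DFunLike.congr_fun (grToSym_grMap_symToGr (R := R) (A := A) n)
    ((symRel R (tangent R A) n).mkQ (grToSym R A n y))
  rw [symMap_mkQ] at h
  rw [map_smul]
  exact h

theorem envMap_injective [Module.Flat ℤ R] : Function.Injective (envMap R A) := by
  refine (injective_iff_map_eq_zero _).2 fun u hu => ?_
  obtain ⟨n, hn⟩ := exists_mem_envFil u
  induction n with
  | zero => simpa [envFil_zero] using hn
  | succ n ih =>
    refine ih ?_
    have h : grMap _ (envFil_le_comap (R := R) (A := A)) n (Submodule.Quotient.mk ⟨u, hn⟩) = 0 := by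
      refine (Submodule.Quotient.mk_eq_zero _).2 ?_
      change envMap R A u ∈ distFil R A n
      rw [hu]
      exact zero_mem _
    exact (Submodule.Quotient.mk_eq_zero ((envFil R (tangent R A) n).submoduleOf _)).1 ((map_eq_zero_iff _ (grMap_injective n)).1 h)

theorem tensorRat_envMap_bijective [Module.Flat ℤ R] (hG : IsFlatInfinitesimalFormalMonoid R A) :
    Function.Bijective (tensorRat
      (envMap R A : UniversalEnvelopingAlgebra R (tangent R A) →ₐ[R] A).toLinearMap) := by
  refine tensorRat_bijective envMap_injective fun a => ?_
  obtain ⟨n, hn⟩ := exists_mem_distFil hG a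
  induction n generalizing a with
  | zero => exact ⟨1, one_ne_zero, 0, by
      rw [distFil_zero, Submodule.mem_bot] at hn
      simp [hn]⟩
  | succ n ih =>
    obtain ⟨u, hu, h⟩ := exists_redComul_envMap (symComul R A n ⟨a, hn⟩)
    rw [tangentTensor_symComul, ← map_smul, eq_comm, ← sub_eq_zero, ← map_sub] at h
    obtain ⟨m, hm, v, hv⟩ := ih _ (mem_distFil_of_redComul_eq_zero
      (sub_mem (Submodule.smul_mem _ _ hn) (envFil_le_comap _ hu)) h)
    refine ⟨m * n.factorial, mul_ne_zero hm n.factorial_ne_zero, v + (m : R) • u, ?_⟩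
    rw [map_add, hv, map_smul, smul_sub, smul_smul, Nat.cast_mul]
    exact sub_add_cancel _ _

theorem comul_eq_iff_mem_range_ι [Module.Flat ℤ R]
    (u : UniversalEnvelopingAlgebra R (tangent R A)) :
    Coalgebra.comul (R := R) u = u ⊗ₜ[R] 1 + 1 ⊗ₜ[R] u ↔
      u ∈ Set.range (UniversalEnvelopingAlgebra.ι R (L := tangent R A)) := by
  constructor
  · intro h
    have h2 : envMap R A u ∈ tangent R A := by
      rw [mem_tangent, ← CoalgHomClass.map_comp_comul_apply, h]
      simp
    exact ⟨⟨_, h2⟩, envMap_injective (envMap_ι _)⟩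
  · rintro ⟨x, rfl⟩
    exact envComul_ι R _ x

end Gamma

end

end InfinitesimalGroup

open InfinitesimalGroup in
theorem mainTheorem10 (R A : Type u) [CommRing R] [Module.Flat ℤ R] [Ring A] [Bialgebra R A]
    [Coalgebra.IsCocomm R A] (hG : IsFlatInfinitesimalFormalGroup R A) :
    ∃ (Φ : UniversalEnvelopingAlgebra R (tangent R A) →ₐc[R] A)
      (hΦ : ∀ n, envFil R (tangent R A) n ≤
        (distFil R A n).comap (Φ : UniversalEnvelopingAlgebra R (tangent R A) →ₐ[R] A).toLinearMap),
      -- `Φ` is the algebra morphism which extends the inclusion of the Lie algebra in `A`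
      (Φ : UniversalEnvelopingAlgebra R (tangent R A) →ₐ[R] A) =
        UniversalEnvelopingAlgebra.lift R (tangent R A).incl ∧
      -- (1)
      Function.Injective Φ ∧
      Function.Bijective
        (tensorRat (Φ : UniversalEnvelopingAlgebra R (tangent R A) →ₐ[R] A).toLinearMap) ∧
      -- (2)
      (∀ n : ℕ,
        ∃ (α : SymPow R (tangent R A) n ≃ₗ[R] Gr (envFil R (tangent R A)) n)
          (γ : Gr (distFil R A) n ≃ₗ[R] symTensors R (tangent R A) n),
          -- `α` is induced by multiplication in the enveloping algebra
          (∀ x : Fin n → tangent R A,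
            α (symProd x) = Submodule.Quotient.mk ⟨_, prod_mem_envFil R x⟩) ∧
          -- `γ` is dual to the multiplication of functions in the augmentation ideal
          (∀ (a : distFil R A (n + 1)) (S : Type u) [CommRing S] [Algebra R S]
            (f : Fin n → WithConv (A →ₗ[R] S)), (∀ i, f i ∈ augIdeal R A S) →
              (∏ i, f i) (a : A) =
                prodPairing (fun i => (f i).ofConv ∘ₗ ((tangent R A).incl : tangent R A →ₗ[R] A))
                  (γ (Submodule.Quotient.mk a) : ⨂[R]^n (tangent R A))) ∧
          -- the morphism of graded pieces is, under `α` and `γ`, the natural one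
          γ.toLinearMap ∘ₗ grMap _ hΦ n ∘ₗ α.toLinearMap = symMap n ∧
          Function.Injective (symMap n : SymPow R (tangent R A) n →ₗ[R] _) ∧
          Function.Injective (grMap _ hΦ n) ∧
          Function.Bijective (tensorRat (symMap n : SymPow R (tangent R A) n →ₗ[R] _)) ∧
          Function.Bijective (tensorRat (grMap _ hΦ n))) ∧
      -- (3)
      Function.Injective (UniversalEnvelopingAlgebra.ι R (L := tangent R A)) ∧
      ∀ u : UniversalEnvelopingAlgebra R (tangent R A),
        Coalgebra.comul (R := R) u = u ⊗ₜ[R] 1 + 1 ⊗ₜ[R] u ↔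
          u ∈ Set.range (UniversalEnvelopingAlgebra.ι R (L := tangent R A)) := by
  have hG' := hG.toIsFlatInfinitesimalFormalMonoid
  have := hG'.flat
  have := flat_tangent hG'
  have := isAddTorsionFree_of_flat R (M := R)
  refine ⟨envMap R A, envFil_le_comap, coe_envMap R A, envMap_injective,
    tensorRat_envMap_bijective hG', fun n => ?_, ?_, comul_eq_iff_mem_range_ι⟩
  · exact ⟨LinearEquiv.ofBijective _ (symToGr_bijective n),
      LinearEquiv.ofBijective _ ⟨grToSym_injective n, grToSym_surjective hG' n⟩, symToGr_symProd,
      fun a S _ _ f hf => prod_apply_eq_prodPairing_symComul a f hf, grToSym_grMap_symToGr n,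
      symMap_injective n, grMap_injective n, tensorRat_symMap_bijective n,
      tensorRat_grMap_bijective n⟩
  · intro x y h
    have h2 := congrArg (envMap R A) h
    rw [envMap_ι, envMap_ι] at h2
    exact Subtype.ext h2
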